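/- **Setting.** Let $P_0\neq P_1$ be mutually absolutely continuous probability measures on $\mathbb R$ with densities $f_0,f_1$, let $\pi_0\in[0,1]$ and $c>0$, and put $g_0=f_0*f_0$, $g_1=f_0*f_1$, $g_2=f_1*f_1$. There are infinitely many independent sequences; each sequence $s$ has hypothesis $H^s=H_1$ with probability $\pi_0$ and $H^s=H_0$ otherwise, and given $H^s=H_i$ its samples $Y^s_1,Y^s_2,\dots$ are i.i.d. with density $f_i$. *Scanning.* At each time the observer watches a pair of sequences and observes the sum of their two samples: $Z_{k+1}=Y^{s^1}_{k+1}+Y^{s^2}_{k+1}$. Let $\mathcal F_k=\sigma(Z_1,\dots,Z_k)$. An $\mathcal F_k$-measurable switching decision $\phi_k\in\{0,1\}$ determines whether observation $k+1$ comes from the same pair ($\phi_k=0$) or from a new, never observed pair ($\phi_k=1$). Scanning ends at an $(\mathcal F_k)$-stopping time $\tau_0$. Let $p^{1,1}_k$ and $p^{mix}_k$ be the conditional probabilities given $\mathcal F_k$ that both, respectively exactly one, of the two sequences watched at time $k$ are generated by $f_1$; so $(p^{1,1}_0,p^{mix}_0)=(\pi_0^2,2\pi_0(1-\pi_0))$.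 *Refinement.* One then observes $X_j=Y^{s^1}_{\tau_0+j}$, $j\ge1$, from the first sequence of the current pair, stops at a stopping time $\tau_1$ of $\mathcal G_j=\sigma(Z_1,\dots,Z_{\tau_0},X_1,\dots,X_j)$, and claims, by a $\mathcal G_{\tau_1}$-measurable decision $\delta$, one of the two sequences of the pair. The total cost is $c\,\mathbb E[\tau_0+\tau_1]+P(H^\delta=H_0)$. *Cost functions.* For $r=(r^{1,1},r^{1,0},r^{0,1})$ let $f(x|r)=f_1(x)(r^{1,1}+r^{1,0})+f_0(x)(1-r^{1,1}-r^{1,0})$ and $r'(x)=\big(f_1(x)r^{1,1},f_1(x)r^{1,0},f_0(x)r^{0,1}\big)/f(x|r)$. Let $V_0(r)=1-\max\{r^{1,1}+r^{1,0},r^{1,1}+r^{0,1}\}$, $V_{n+1}(r)=\min\{V_0(r),\,c+\int V_n(r'(x))f(x|r)\,dx\}$, $V=\lim_n V_n$ and $v(p^{1,1},p^{mix})=V(p^{1,1},p^{mix}/2,p^{mix}/2)$. Let $$\mathcal P=\{(p^{1,1},p^{mix}):0\le p^{1,1}\le1,\;0\le p^{mix}\le1,\;0\le p^{1,1}+p^{mix}\le1\}.$$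 For $p=(p^{1,1},p^{mix})\in\mathcal P$ let $g(p,z)=(1-p^{1,1}-p^{mix})g_0(z)+p^{mix}g_1(z)+p^{1,1}g_2(z)$ and $p'(z)=\big(p^{1,1}g_2(z),p^{mix}g_1(z)\big)/g(p,z)$; for a function $W$ on $\mathcal P$ let $(\mathcal E W)(p)=\int W(p'(z))\,g(p,z)\,dz$. Let $p_0=(\pi_0^2,2\pi_0(1-\pi_0))$, $U_0=v$, $U_{n+1}(p)=\min\{v(p),\,c+\min\{(\mathcal E U_n)(p),(\mathcal E U_n)(p_0)\}\}$, $U=\lim_n U_n$, $\Phi_c=\mathcal E U$ and $\Phi_s=\Phi_c(p_0)$. **Theorem.** There are Borel sets $R_\tau,R_\phi\subseteq\mathcal P$, depending only on $f_0,f_1,\pi_0,c$, namely $R_\tau=\{p\in\mathcal P:v(p)=U(p)\}$ and $R_\phi=\{p\in\mathcal P:\Phi_c(p)>\Phi_s\}$, such that the following rules are optimal: $$\tau_0^*=\min\{k\ge0:(p^{1,1}_k,p^{mix}_k)\in R_\tau\},\qquad \phi^*_k=\begin{cases}1&\text{if }(p^{1,1}_k,p^{mix}_k)\in R_\phi,\\0&\text{otherwise.}\end{cases}$$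 Precisely: a switching rule $\phi^*$ of this form (almost surely, for all $k$) exists, and for every such rule $\tau_0^*$ is an almost surely finite stopping time; $(\tau_0^*,\phi^*)$ minimizes $\mathbb E[c\tau_0+v(p^{1,1}_{\tau_0},p^{mix}_{\tau_0})]$ over all $(\tau_0,\phi)$; and there are $\tau_1^*,\delta^*$ such that $(\tau_0^*,\phi^*,\tau_1^*,\delta^*)$ minimizes the total cost over all $(\tau_0,\phi,\tau_1,\delta)$. -/

import Mathlib

open MeasureTheory ProbabilityTheory Set
open scoped ENNReal

universe u

noncomputable section

/-- A probability density function on the real line (with respect to Lebesgue measure). -/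
structure ProbDensity where
  f : ℝ → ℝ
  measurable : Measurable f
  nonneg : ∀ x, 0 ≤ f x
  lintegral_eq_one : ∫⁻ x, ENNReal.ofReal (f x) = 1

namespace ProbDensity

/-- The probability measure with the given density. -/
def law (d : ProbDensity) : Measure ℝ := volume.withDensity fun x => ENNReal.ofReal (d.f x)

instance (d : ProbDensity) : IsProbabilityMeasure d.law :=
  ⟨by simpa [law] using d.lintegral_eq_one⟩

/-- The density of the sum of two independent samples, `d * e`. -/
def conv (d e : ProbDensity) : ℝ → ℝ :=
  convolution d.f e.f (ContinuousLinearMap.lsmul ℝ ℝ) volume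

end ProbDensity

/-! ### The optimal cost functions -/

section Values

variable (f₀ f₁ : ProbDensity) (π₀ c : ℝ)

/-- The domain of the scanning statistics `(p^{1,1}, p^{mix})`. -/
def scanDomain : Set (ℝ × ℝ) :=
  {p | 0 ≤ p.1 ∧ p.1 ≤ 1 ∧ 0 ≤ p.2 ∧ p.2 ≤ 1 ∧ 0 ≤ p.1 + p.2 ∧ p.1 + p.2 ≤ 1}

/-- The predictive density of the next refinement sample in state
`r = (r^{1,1}, r^{1,0}, r^{0,1})`; note `r^{0,1} + r^{0,0} = 1 - r^{1,1} - r^{1,0}`. -/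
def refineDensity (r : ℝ × ℝ × ℝ) (x : ℝ) : ℝ :=
  f₁.f x * (r.1 + r.2.1) + f₀.f x * (1 - r.1 - r.2.1)

/-- Bayes update of the refinement statistics after the sample `x`. -/
def refineUpdate (r : ℝ × ℝ × ℝ) (x : ℝ) : ℝ × ℝ × ℝ :=
  (f₁.f x * r.1 / refineDensity f₀ f₁ r x,
    f₁.f x * r.2.1 / refineDensity f₀ f₁ r x,
    f₀.f x * r.2.2 / refineDensity f₀ f₁ r x)

/-- The false identification probability on stopping in state `r`: `1 - max {q₁, q₂}`. -/
def refineStopCost (r : ℝ × ℝ × ℝ) : ℝ := 1 - max (r.1 + r.2.1) (r.1 + r.2.2)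

/-- The optimal refinement cost when at most `n` further samples may be taken. -/
def refineValueUpTo : ℕ → ℝ × ℝ × ℝ → ℝ
  | 0, r => refineStopCost r
  | n + 1, r => min (refineStopCost r)
      (c + ∫ x, refineValueUpTo n (refineUpdate f₀ f₁ r x) * refineDensity f₀ f₁ r x)

/-- The optimal refinement cost `V`: the limit of the non-increasing sequence of
finite-horizon costs. -/
def refineValue (r : ℝ × ℝ × ℝ) : ℝ := ⨅ n : ℕ, refineValueUpTo f₀ f₁ c n r

/-- The cost `v(p^{1,1}, p^{mix}) = V(p^{1,1}, p^{mix}/2, p^{mix}/2)` of entering the refinement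
stage in the scanning state `p`. -/
def scanStopCost (p : ℝ × ℝ) : ℝ := refineValue f₀ f₁ c (p.1, p.2 / 2, p.2 / 2)

/-- The predictive density `p^{0,0} g₀ + p^{mix} g₁ + p^{1,1} g₂` of the next mixed observation. -/
def scanDensity (p : ℝ × ℝ) (z : ℝ) : ℝ :=
  (1 - p.1 - p.2) * f₀.conv f₀ z + p.2 * f₀.conv f₁ z + p.1 * f₁.conv f₁ z

/-- Bayes update of the scanning statistics after the mixed observation `z`. -/
def scanUpdate (p : ℝ × ℝ) (z : ℝ) : ℝ × ℝ :=
  (p.1 * f₁.conv f₁ z / scanDensity f₀ f₁ p z, p.2 * f₀.conv f₁ z / scanDensity f₀ f₁ p z)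

/-- The statistics of a fresh pair of sequences. -/
def scanPrior : ℝ × ℝ := (π₀ ^ 2, 2 * π₀ * (1 - π₀))

/-- `E[W(p_{k+1}) | p_k = p]` when the next observation comes from a pair in state `p`. -/
def scanExpect (W : ℝ × ℝ → ℝ) (p : ℝ × ℝ) : ℝ :=
  ∫ z, W (scanUpdate f₀ f₁ p z) * scanDensity f₀ f₁ p z

/-- The optimal scanning cost when at most `n` further mixed observations may be taken. -/
def scanValueUpTo : ℕ → ℝ × ℝ → ℝ
  | 0, p => scanStopCost f₀ f₁ c p
  | n + 1, p => min (scanStopCost f₀ f₁ c p)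
      (c + min (scanExpect f₀ f₁ (scanValueUpTo n) p)
        (scanExpect f₀ f₁ (scanValueUpTo n) (scanPrior π₀)))

/-- The optimal scanning cost `U`: the limit of the non-increasing sequence of
finite-horizon costs. -/
def scanValue (p : ℝ × ℝ) : ℝ := ⨅ n : ℕ, scanValueUpTo f₀ f₁ π₀ c n p

/-- `Φ_c`: the expected optimal future cost when the observer keeps the current pair. -/
def continueCost (p : ℝ × ℝ) : ℝ := scanExpect f₀ f₁ (scanValue f₀ f₁ π₀ c) p

/-- `Φ_s`: the expected optimal future cost when the observer switches to a new pair. -/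
def switchCost : ℝ := scanExpect f₀ f₁ (scanValue f₀ f₁ π₀ c) (scanPrior π₀)

end Values

/-! ### The search problem -/

/-- Infinitely many independent sequences. `H s = true` means that sequence `s` is generated by
`f₁`, which has probability `π₀`; given `H s`, the samples `Y s k` are i.i.d. with density `f₁`
(if `H s = true`) or `f₀` (if `H s = false`). `Y s k` is the sample of sequence `s` at time `k`;
times start at `1`, the sample at time `0` is never observed. -/
structure SearchModel (f₀ f₁ : ProbDensity) (π₀ : ℝ) {Ω : Type u} [MeasurableSpace Ω]
    (P : Measure Ω) where
  H : ℕ → Ω → Bool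
  Y : ℕ → ℕ → Ω → ℝ
  measurable_H : ∀ s, Measurable (H s)
  measurable_Y : ∀ s k, Measurable (Y s k)
  indep : iIndepFun (fun s ω => (H s ω, fun k => Y s k ω)) P
  law : ∀ s, P.map (fun ω => (H s ω, fun k => Y s k ω)) =
    ENNReal.ofReal π₀ •
        (Measure.dirac true).prod (Measure.infinitePi fun _ : ℕ => f₁.law) +
      ENNReal.ofReal (1 - π₀) •
        (Measure.dirac false).prod (Measure.infinitePi fun _ : ℕ => f₀.law)

/-- A switching rule: on the basis of the first `k` mixed observations it decides whether
(`true`) or not (`false`) to switch to a new pair of sequences for observation `k + 1`. -/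
structure SwitchRule where
  rule : (k : ℕ) → (Fin k → ℝ) → Bool
  measurable : ∀ k, Measurable (rule k)

namespace SearchModel

variable {f₀ f₁ : ProbDensity} {π₀ : ℝ} {Ω : Type u} [mΩ : MeasurableSpace Ω] {P : Measure Ω}
  (M : SearchModel f₀ f₁ π₀ P) (φ : SwitchRule)

/-- At time `k`: the number `n` of the current pair, which consists of the sequences `2 n` and
`2 n + 1`, and the vector `(Z_1, ..., Z_k)` of mixed observations, where
`Z_{k+1} = Y_{k+1}^{2 n} + Y_{k+1}^{2 n + 1}` for the pair `n` observed at time `k + 1`. -/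
def path : (k : ℕ) → Ω → ℕ × (Fin k → ℝ)
  | 0, _ => (0, Fin.elim0)
  | k + 1, ω =>
    let h := path k ω
    let n := if φ.rule k h.2 then h.1 + 1 else h.1
    (n, Fin.snoc (α := fun _ => ℝ) h.2 (M.Y (2 * n) (k + 1) ω + M.Y (2 * n + 1) (k + 1) ω))

/-- The number of the pair under observation at time `k`. -/
def pair (k : ℕ) (ω : Ω) : ℕ := (M.path φ k ω).1

/-- The mixed observations `(Z_1, ..., Z_k)`. -/
def hist (k : ℕ) (ω : Ω) : Fin k → ℝ := (M.path φ k ω).2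

theorem measurable_Y_comp {N K : Ω → ℕ} (hN : Measurable N) (hK : Measurable K) :
    Measurable fun ω => M.Y (N ω) (K ω) ω := by
  have h : Measurable fun q : (ℕ × ℕ) × Ω => M.Y q.1.1 q.1.2 q.2 :=
    measurable_from_prod_countable_right fun i => M.measurable_Y i.1 i.2
  exact h.comp ((hN.prodMk hK).prodMk measurable_id)

theorem measurable_path (k : ℕ) : Measurable (M.path φ k) := by
  induction k with
  | zero => exact measurable_const
  | succ k ih =>
    have hn : Measurable fun ω => if φ.rule k (M.path φ k ω).2 then (M.path φ k ω).1 + 1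
        else (M.path φ k ω).1 := by
      refine Measurable.ite ?_ (ih.fst.add_const 1) ih.fst
      exact ((φ.measurable k).comp ih.snd) (measurableSet_singleton true)
    refine hn.prodMk (measurable_pi_iff.2 fun i => ?_)
    refine Fin.lastCases ?_ (fun j => ?_) i
    · simp only [Fin.snoc_last]
      exact (M.measurable_Y_comp (hn.const_mul 2) measurable_const).add
        (M.measurable_Y_comp ((hn.const_mul 2).add_const 1) measurable_const)
    · simp only [Fin.snoc_castSucc]
      exact (measurable_pi_apply j).comp ih.snd

/-- `F_k = σ(Z_1, ..., Z_k)`. -/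
def scanFiltration : Filtration ℕ mΩ where
  seq k := MeasurableSpace.comap (M.hist φ k) inferInstance
  mono' := monotone_nat_of_le_succ fun k => by
    have h : M.hist φ k =
        (fun (y : Fin (k + 1) → ℝ) (i : Fin k) => y i.castSucc) ∘ M.hist φ (k + 1) := by
      funext ω i
      simp [hist, path]
    rw [h, ← MeasurableSpace.comap_comp]
    exact MeasurableSpace.comap_mono
      (measurable_pi_iff.2 fun i => measurable_pi_apply i.castSucc).comap_le
  le' k := (M.measurable_path φ k).snd.comap_le

/-- The posterior probabilities `(p_k^{1,1}, p_k^{mix})`, given `F_k`, that both sequences,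
respectively exactly one of the two sequences, under observation at time `k` are generated by
`f₁`. -/
def posterior (k : ℕ) (ω : Ω) : ℝ × ℝ :=
  ((P[{ω | M.H (2 * M.pair φ k ω) ω = true ∧
        M.H (2 * M.pair φ k ω + 1) ω = true}.indicator (fun _ => (1 : ℝ)) |
      M.scanFiltration φ k]) ω,
    (P[{ω | M.H (2 * M.pair φ k ω) ω ≠
        M.H (2 * M.pair φ k ω + 1) ω}.indicator (fun _ => (1 : ℝ)) |
      M.scanFiltration φ k]) ω)

/-- The rule `φ` switches exactly when the posterior state lies in `R` (almost surely). -/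
def SwitchesExactlyOn (R : Set (ℝ × ℝ)) : Prop :=
  ∀ᵐ ω ∂P, ∀ k, φ.rule k (M.hist φ k ω) = true ↔ M.posterior φ k ω ∈ R

/-- The expected scanning cost `E[c τ₀ + v(p_{τ₀}^{1,1}, p_{τ₀}^{mix})]`. (The value of the
statistics at an infinite time is immaterial: the cost is then infinite.) -/
def scanCost (c : ℝ) (τ₀ : Ω → WithTop ℕ) : ℝ≥0∞ :=
  ENNReal.ofReal c * ∫⁻ ω, ENat.toENNReal (τ₀ ω) ∂P +
    ∫⁻ ω, ENNReal.ofReal (scanStopCost f₀ f₁ c (M.posterior φ ((τ₀ ω).untopD 0) ω)) ∂P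

/-- The refinement sample `X_j`: the sample at time `τ₀ + j` of the first of the two sequences
that are under observation at the end of the scanning stage. -/
def refineSample (τ₀ : Ω → WithTop ℕ) (j : ℕ) (ω : Ω) : ℝ :=
  M.Y (2 * M.pair φ ((τ₀ ω).untopD 0) ω) ((τ₀ ω).untopD 0 + j) ω

theorem measurable_untopD {τ₀ : Ω → WithTop ℕ} (hτ₀ : IsStoppingTime (M.scanFiltration φ) τ₀) :
    Measurable fun ω => (τ₀ ω).untopD 0 := by
  have h1 : ∀ n : ℕ, MeasurableSet {ω | τ₀ ω = n} := fun n =>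
    (M.scanFiltration φ).le n _ (hτ₀.measurableSet_eq n)
  refine measurable_to_countable' fun n => ?_
  have h2 : MeasurableSet {ω | τ₀ ω = ⊤} := by
    have : {ω | τ₀ ω = ⊤} = (⋃ n : ℕ, {ω | τ₀ ω = n})ᶜ := by
      ext ω
      cases h : τ₀ ω <;> simp [h]
    rw [this]
    exact (MeasurableSet.iUnion h1).compl
  have h3 : (fun ω => (τ₀ ω).untopD 0) ⁻¹' {n} =
      {ω | τ₀ ω = n} ∪ ({ω | τ₀ ω = ⊤} ∩ {_ω | n = 0}) := by
    ext ω
    cases h : τ₀ ω with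
    | top => simp [h, eq_comm]
    | coe a =>
      simp [h]
      exact Iff.rfl
  rw [h3]
  exact (h1 n).union (h2.inter (MeasurableSet.const _))

theorem measurable_refineSample {τ₀ : Ω → WithTop ℕ}
    (hτ₀ : IsStoppingTime (M.scanFiltration φ) τ₀) (j : ℕ) :
    Measurable (M.refineSample φ τ₀ j) := by
  have hτ := M.measurable_untopD φ hτ₀
  have hp : Measurable fun q : ℕ × Ω => M.pair φ q.1 q.2 :=
    measurable_from_prod_countable_right fun k => (M.measurable_path φ k).fst
  exact M.measurable_Y_comp ((hp.comp (hτ.prodMk measurable_id)).const_mul 2) (hτ.add_const j)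

/-- `G_j = σ(Z_1, ..., Z_{τ₀}, X_1, ..., X_j)`. -/
def refineFiltration {τ₀ : Ω → WithTop ℕ} (hτ₀ : IsStoppingTime (M.scanFiltration φ) τ₀) :
    Filtration ℕ mΩ where
  seq j := hτ₀.measurableSpace ⊔
    ⨆ i ∈ Set.Icc 1 j, MeasurableSpace.comap (M.refineSample φ τ₀ i) inferInstance
  mono' _ _ hij := sup_le_sup_left
    (biSup_mono fun _ hi => ⟨hi.1, hi.2.trans hij⟩) _
  le' _ := sup_le hτ₀.measurableSpace_le
    (iSup₂_le fun i _ => (M.measurable_refineSample φ hτ₀ i).comap_le)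

/-- A refinement strategy following the scanning stage `(φ, τ₀)`: the stopping time `τ₁` and the
terminal decision `δ`, which claims the first (`true`) or the second (`false`) sequence of the
pair under observation at time `τ₀`. -/
structure Refinement {τ₀ : Ω → WithTop ℕ} (hτ₀ : IsStoppingTime (M.scanFiltration φ) τ₀) where
  τ₁ : Ω → WithTop ℕ
  isStoppingTime : IsStoppingTime (M.refineFiltration φ hτ₀) τ₁
  δ : Ω → Bool
  measurable_δ : Measurable[isStoppingTime.measurableSpace] δ

/-- The total cost `c E[τ₀ + τ₁] + P(H^δ = H₀)` of a two-stage strategy. -/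
def totalCost (c : ℝ) {τ₀ : Ω → WithTop ℕ} (hτ₀ : IsStoppingTime (M.scanFiltration φ) τ₀)
    (ρ : M.Refinement φ hτ₀) : ℝ≥0∞ :=
  ENNReal.ofReal c * ∫⁻ ω, ENat.toENNReal (τ₀ ω + ρ.τ₁ ω) ∂P +
    P {ω | M.H (2 * M.pair φ ((τ₀ ω).untopD 0) ω + if ρ.δ ω then 0 else 1) ω = false}

end SearchModel

end

/-! The hypotheses of a fresh pair are independent of the past and, given the hypotheses, the
samples are independent. Hence, given the past, the next observation has the density `g(p, ·)`
(`f(· | r)` in the refinement stage) of the current statistics, and Bayes' rule shows that the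
recursively computed statistics are versions of the posterior probabilities. In both stages they
form a controlled Markov process.

The limit of the finite-horizon values satisfies the Bellman equation. For every strategy, the cost
so far plus the value of the current state is therefore a submartingale. Up to the hitting time of
the stopping set it is a martingale if the observer switches exactly where switching is better.
Stopping costs are bounded and every observation costs `c > 0`, so this hitting time is almost
surely finite, and the value of the initial state is the optimal cost.

By the tower property, the error probability of a decision is at least the expected posterior
probability that the sequence more likely to have `H_1` has `H_0`, with equality if this sequence is
claimed. The optimal cost of the refinement stage is therefore `v` of the statistics at which
scanning stops, so `v` is the stopping cost of the scanning stage and the two stages decouple. -/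

noncomputable section

open Filter Topology

namespace ProbDensity

variable (d e : ProbDensity)

theorem lintegral_law {F : ℝ → ℝ≥0∞} (hF : Measurable F) :
    ∫⁻ x, F x ∂d.law = ∫⁻ x, F x * ENNReal.ofReal (d.f x) := by
  rw [law, lintegral_withDensity_eq_lintegral_mul _ d.measurable.ennreal_ofReal hF]
  exact lintegral_congr fun x => mul_comm _ _

theorem conv_nonneg (x : ℝ) : 0 ≤ d.conv e x :=
  integral_nonneg fun t => mul_nonneg (d.nonneg t) (e.nonneg (x - t))

theorem measurable_conv : Measurable (d.conv e) := by
  have h : Measurable (Function.uncurry fun x t : ℝ => d.f t * e.f (x - t)) :=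
    (d.measurable.comp measurable_snd).mul (e.measurable.comp (measurable_fst.sub measurable_snd))
  exact h.stronglyMeasurable.integral_prod_right.measurable

theorem conv_comm : d.conv e = e.conv d := by
  funext x
  calc d.conv e x = ∫ t, d.f (x - t) * e.f t := convolution_lsmul_swap
    _ = e.conv d x := integral_congr_ae (ae_of_all _ fun t => mul_comm _ _)

theorem conv_eq_toReal_lconvolution (x : ℝ) : d.conv e x =
    (lconvolution (fun t => ENNReal.ofReal (d.f t)) (fun t => ENNReal.ofReal (e.f t))
      volume x).toReal := by
  change ∫ t, d.f t * e.f (x - t) = _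
  rw [integral_eq_lintegral_of_nonneg_ae
    (ae_of_all _ fun t => mul_nonneg (d.nonneg t) (e.nonneg (x - t)))
    (d.measurable.mul
      (e.measurable.comp (measurable_const.sub measurable_id))).aestronglyMeasurable]
  simp_rw [lconvolution, neg_add_eq_sub, ENNReal.ofReal_mul (d.nonneg _)]

theorem law_conv_law : d.law.conv e.law =
    volume.withDensity fun x => ENNReal.ofReal (d.conv e x) := by
  have hd := d.measurable.ennreal_ofReal
  have he := e.measurable.ennreal_ofReal
  have hconv : d.law.conv e.law = _ := conv_withDensity_eq_lconvolution hd he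
  have hfin : ∫⁻ x, lconvolution (fun t => ENNReal.ofReal (d.f t))
      (fun t => ENNReal.ofReal (e.f t)) volume x ≠ ∞ := by
    rw [← setLIntegral_univ, ← withDensity_apply _ MeasurableSet.univ, ← hconv]
    exact measure_ne_top _ _
  rw [hconv]
  refine withDensity_congr_ae ?_
  filter_upwards [ae_lt_top (measurable_lconvolution volume hd he) hfin] with x hx
  rw [conv_eq_toReal_lconvolution, ENNReal.ofReal_toReal hx.ne]

theorem lintegral_conv : ∫⁻ x, ENNReal.ofReal (d.conv e x) = 1 := by
  rw [← setLIntegral_univ, ← withDensity_apply _ MeasurableSet.univ, ← law_conv_law]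
  exact measure_univ

/-- The density of the sum of two independent samples, as a probability density. -/
def convolve : ProbDensity where
  f := d.conv e
  measurable := d.measurable_conv e
  nonneg := d.conv_nonneg e
  lintegral_eq_one := d.lintegral_conv e

theorem law_convolve : (d.convolve e).law = d.law.conv e.law := (d.law_conv_law e).symm

end ProbDensity

/-- A Bayes filter for an unknown `Θ`-valued parameter: an observation has the density `obs a` if
the parameter is `a`, the state `x` stands for the posterior weights `weight x`, and the
observation `z` moves the state `x` to `update x z`. A state may have negative weights; those that
have none form the domain `dom`. The last two fields are Bayes' rule, where an observation of
predictive density `0` may lead to any state of the domain. -/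
structure BayesFilter (Θ X : Type*) [Fintype Θ] [MeasurableSpace X] where
  obs : Θ → ProbDensity
  weight : X → Θ → ℝ
  update : X → ℝ → X
  measurable_weight : ∀ a, Measurable fun x => weight x a
  measurable_update : Measurable (Function.uncurry update)
  sum_weight : ∀ x, ∑ a, weight x a = 1
  weight_update_nonneg : ∀ x, (∀ a, 0 ≤ weight x a) → ∀ z a, 0 ≤ weight (update x z) a
  weight_update_mul_sum : ∀ x z, ∑ b, weight x b * (obs b).f z ≠ 0 → ∀ a,
    weight (update x z) a * ∑ b, weight x b * (obs b).f z = weight x a * (obs a).f z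

namespace BayesFilter

variable {Θ X : Type*} [Fintype Θ] [MeasurableSpace X] (B : BayesFilter Θ X)

/-- The states with nonnegative weights, that is, with a probability vector of weights. -/
def dom : Set X := {x | ∀ a, 0 ≤ B.weight x a}

/-- The predictive density of the next observation. -/
def density (x : X) (z : ℝ) : ℝ := ∑ a, B.weight x a * (B.obs a).f z

/-- The expected value of `W` at the next state. -/
def expect (W : X → ℝ) (x : X) : ℝ := ∫ z, W (B.update x z) * B.density x z

theorem measurableSet_dom : MeasurableSet B.dom := by
  simp only [dom, ofPred_forall]
  exact MeasurableSet.iInter fun a => measurableSet_le measurable_const (B.measurable_weight a)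

theorem measurable_density : Measurable (Function.uncurry B.density) :=
  Finset.measurable_fun_sum _ fun a _ =>
    ((B.measurable_weight a).comp measurable_fst).mul ((B.obs a).measurable.comp measurable_snd)

theorem measurable_expect {W : X → ℝ} (hW : Measurable W) : Measurable (B.expect W) := by
  have : Measurable (Function.uncurry fun x z => W (B.update x z) * B.density x z) :=
    (hW.comp B.measurable_update).mul B.measurable_density
  exact this.stronglyMeasurable.integral_prod_right.measurable

variable {B}

theorem measurable_density_left (x : X) : Measurable (B.density x) :=
  B.measurable_density.comp measurable_prodMk_left

theorem measurable_update_left (x : X) : Measurable (B.update x) :=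
  B.measurable_update.comp measurable_prodMk_left

section Dom

variable {W W' : X → ℝ} {x : X} (hx : x ∈ B.dom)

include hx

theorem update_mem_dom (z : ℝ) : B.update x z ∈ B.dom := B.weight_update_nonneg x hx z

theorem weight_mul_obs_nonneg (z : ℝ) (a : Θ) : 0 ≤ B.weight x a * (B.obs a).f z :=
  mul_nonneg (hx a) ((B.obs a).nonneg z)

theorem density_nonneg (z : ℝ) : 0 ≤ B.density x z :=
  Finset.sum_nonneg fun a _ => weight_mul_obs_nonneg hx z a

theorem weight_update_mul_density (z : ℝ) (a : Θ) :
    B.weight (B.update x z) a * B.density x z = B.weight x a * (B.obs a).f z := by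
  by_cases hz : B.density x z = 0
  · have hzero := (Finset.sum_eq_zero_iff_of_nonneg fun a _ => weight_mul_obs_nonneg hx z a).1 hz
    rw [hz, mul_zero, hzero a (Finset.mem_univ a)]
  · exact B.weight_update_mul_sum x z hz a

theorem ofReal_density (z : ℝ) : ENNReal.ofReal (B.density x z) =
    ∑ a, ENNReal.ofReal (B.weight x a) * ENNReal.ofReal ((B.obs a).f z) := by
  rw [density, ENNReal.ofReal_sum_of_nonneg fun a _ => weight_mul_obs_nonneg hx z a]
  simp_rw [ENNReal.ofReal_mul (hx _)]

theorem sum_ofReal_weight : ∑ a, ENNReal.ofReal (B.weight x a) = 1 := by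
  rw [← ENNReal.ofReal_sum_of_nonneg fun a _ => hx a, B.sum_weight, ENNReal.ofReal_one]

theorem lintegral_density : ∫⁻ z, ENNReal.ofReal (B.density x z) = 1 := by
  simp_rw [ofReal_density hx]
  rw [lintegral_finsetSum _ fun a _ => (B.obs a).measurable.ennreal_ofReal.const_mul _]
  simp_rw [lintegral_const_mul _ (B.obs _).measurable.ennreal_ofReal,
    ProbDensity.lintegral_eq_one, mul_one, sum_ofReal_weight hx]

theorem integrable_density : Integrable (B.density x) := by
  refine ⟨(measurable_density_left x).aestronglyMeasurable, ?_⟩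
  rw [hasFiniteIntegral_iff_ofReal (ae_of_all _ (density_nonneg hx)), lintegral_density hx]
  exact ENNReal.one_lt_top

theorem integrable_expect (hW : Measurable W) (hW01 : ∀ x ∈ B.dom, W x ∈ Icc (0 : ℝ) 1) :
    Integrable fun z => W (B.update x z) * B.density x z := by
  refine (integrable_density hx).mono ((hW.comp (measurable_update_left x)).mul
    (measurable_density_left x)).aestronglyMeasurable (ae_of_all _ fun z => ?_)
  have hWz := hW01 _ (update_mem_dom hx z)
  rw [norm_mul, Real.norm_of_nonneg hWz.1]
  exact mul_le_of_le_one_left (norm_nonneg _) hWz.2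

theorem ofReal_expect (hW : Measurable W) (hW01 : ∀ x ∈ B.dom, W x ∈ Icc (0 : ℝ) 1) :
    ENNReal.ofReal (B.expect W x) =
      ∫⁻ z, ENNReal.ofReal (W (B.update x z)) * ENNReal.ofReal (B.density x z) := by
  have hW0 := fun z => (hW01 _ (update_mem_dom hx z)).1
  rw [expect, ofReal_integral_eq_lintegral_ofReal (integrable_expect hx hW hW01)
    (ae_of_all _ fun z => mul_nonneg (hW0 z) (density_nonneg hx z))]
  exact lintegral_congr fun z => ENNReal.ofReal_mul (hW0 z)

theorem expect_mono (hW : Measurable W) (hW01 : ∀ x ∈ B.dom, W x ∈ Icc (0 : ℝ) 1)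
    (hW' : Measurable W') (hW'01 : ∀ x ∈ B.dom, W' x ∈ Icc (0 : ℝ) 1)
    (hle : ∀ x ∈ B.dom, W x ≤ W' x) : B.expect W x ≤ B.expect W' x :=
  integral_mono (integrable_expect hx hW hW01) (integrable_expect hx hW' hW'01) fun z =>
    mul_le_mul_of_nonneg_right (hle _ (update_mem_dom hx z)) (density_nonneg hx z)

theorem expect_nonneg (hW : ∀ x ∈ B.dom, 0 ≤ W x) : 0 ≤ B.expect W x :=
  integral_nonneg fun z => mul_nonneg (hW _ (update_mem_dom hx z)) (density_nonneg hx z)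

theorem tendsto_expect {w : ℕ → X → ℝ} (hw : ∀ n, Measurable (w n))
    (hw01 : ∀ n, ∀ x ∈ B.dom, w n x ∈ Icc (0 : ℝ) 1)
    (hlim : ∀ x ∈ B.dom, Tendsto (fun n => w n x) atTop (𝓝 (W x))) :
    Tendsto (fun n => B.expect (w n) x) atTop (𝓝 (B.expect W x)) := by
  refine tendsto_integral_of_dominated_convergence (B.density x)
    (fun n => (integrable_expect hx (hw n) (hw01 n)).aestronglyMeasurable) (integrable_density hx)
    (fun n => ae_of_all _ fun z => ?_)
    (ae_of_all _ fun z => (hlim _ (update_mem_dom hx z)).mul_const _)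
  have hwz := hw01 n _ (update_mem_dom hx z)
  rw [norm_mul, Real.norm_of_nonneg hwz.1, Real.norm_of_nonneg (density_nonneg hx z)]
  exact mul_le_of_le_one_left (density_nonneg hx z) hwz.2

end Dom

/-- An optimal stopping problem for the filter `B`: in the state `x` one either stops, at the cost
`stopCost x`, or makes a further observation, at the cost `obsCost`, with or without first moving
the state to `reset x`. -/
structure StoppingProblem (B : BayesFilter Θ X) where
  stopCost : X → ℝ
  reset : X → X
  obsCost : ℝ
  measurable_stopCost : Measurable stopCost
  measurable_reset : Measurable reset
  stopCost_mem : ∀ x ∈ B.dom, stopCost x ∈ Icc (0 : ℝ) 1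
  reset_mem : ∀ x ∈ B.dom, reset x ∈ B.dom
  obsCost_pos : 0 < obsCost

namespace StoppingProblem

variable (S : StoppingProblem B)

/-- The optimal cost with at most `n` further observations. -/
def valueUpTo : ℕ → X → ℝ
  | 0, x => S.stopCost x
  | n + 1, x => min (S.stopCost x)
      (S.obsCost + min (B.expect (valueUpTo n) x) (B.expect (valueUpTo n) (S.reset x)))

/-- The optimal cost without a bound on the number of observations. -/
def value (x : X) : ℝ := ⨅ n : ℕ, S.valueUpTo n x

theorem measurable_valueUpTo (n : ℕ) : Measurable (S.valueUpTo n) := by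
  induction n with
  | zero => exact S.measurable_stopCost
  | succ n ih =>
    exact S.measurable_stopCost.min (measurable_const.add
      ((B.measurable_expect ih).min ((B.measurable_expect ih).comp S.measurable_reset)))

theorem measurable_value : Measurable S.value := Measurable.iInf S.measurable_valueUpTo

theorem valueUpTo_mem (n : ℕ) : ∀ x ∈ B.dom, S.valueUpTo n x ∈ Icc (0 : ℝ) 1 := by
  induction n with
  | zero => exact S.stopCost_mem
  | succ n ih =>
    have hnonneg : ∀ x ∈ B.dom, 0 ≤ B.expect (S.valueUpTo n) x := fun x hx =>
      expect_nonneg hx fun y hy => (ih y hy).1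
    exact fun x hx => ⟨le_min (S.stopCost_mem x hx).1 (add_nonneg S.obsCost_pos.le
      (le_min (hnonneg x hx) (hnonneg _ (S.reset_mem x hx)))),
      (min_le_left _ _).trans (S.stopCost_mem x hx).2⟩

theorem valueUpTo_succ_le (n : ℕ) :
    ∀ x ∈ B.dom, S.valueUpTo (n + 1) x ≤ S.valueUpTo n x := by
  induction n with
  | zero => exact fun x _ => min_le_left _ _
  | succ n ih =>
    have hexpect : ∀ x ∈ B.dom, B.expect (S.valueUpTo (n + 1)) x ≤ B.expect (S.valueUpTo n) x :=
      fun x hx => expect_mono hx (S.measurable_valueUpTo _) (S.valueUpTo_mem _)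
        (S.measurable_valueUpTo _) (S.valueUpTo_mem _) ih
    exact fun x hx => min_le_min_left _ (add_le_add_right
      (min_le_min (hexpect x hx) (hexpect _ (S.reset_mem x hx))) _)

variable {x : X} (hx : x ∈ B.dom)

include hx

theorem tendsto_valueUpTo : Tendsto (fun n => S.valueUpTo n x) atTop (𝓝 (S.value x)) :=
  tendsto_atTop_ciInf (antitone_nat_of_succ_le fun n => S.valueUpTo_succ_le n x hx)
    ⟨0, forall_mem_range.2 fun n => (S.valueUpTo_mem n x hx).1⟩

theorem value_mem : S.value x ∈ Icc (0 : ℝ) 1 :=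
  isClosed_Icc.mem_of_tendsto (S.tendsto_valueUpTo hx)
    (Eventually.of_forall fun n => S.valueUpTo_mem n x hx)

theorem value_eq_min : S.value x = min (S.stopCost x)
    (S.obsCost + min (B.expect S.value x) (B.expect S.value (S.reset x))) := by
  have hexpect : ∀ y ∈ B.dom,
      Tendsto (fun n => B.expect (S.valueUpTo n) y) atTop (𝓝 (B.expect S.value y)) :=
    fun y hy => tendsto_expect hy S.measurable_valueUpTo S.valueUpTo_mem
      fun _ hz => S.tendsto_valueUpTo hz
  exact tendsto_nhds_unique ((tendsto_add_atTop_iff_nat 1).2 (S.tendsto_valueUpTo hx))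
    (tendsto_const_nhds.min (tendsto_const_nhds.add
      ((hexpect x hx).min (hexpect _ (S.reset_mem x hx)))))

theorem value_le_stopCost : S.value x ≤ S.stopCost x :=
  (S.value_eq_min hx).trans_le (min_le_left _ _)

omit hx

/-- The states in which it is optimal to stop. -/
def stopSet : Set X := {x ∈ B.dom | S.stopCost x = S.value x}

/-- The states in which moving to `reset x` before the next observation is strictly better. -/
def switchSet : Set X := {x ∈ B.dom | ¬ B.expect S.value x ≤ B.expect S.value (S.reset x)}

theorem measurableSet_stopSet : MeasurableSet S.stopSet :=
  B.measurableSet_dom.inter (measurableSet_eq_fun S.measurable_stopCost S.measurable_value)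

theorem measurableSet_switchSet : MeasurableSet S.switchSet := by
  have hexpect := B.measurable_expect S.measurable_value
  exact B.measurableSet_dom.inter
    (measurableSet_le hexpect (hexpect.comp S.measurable_reset)).compl

include hx in
theorem value_eq_of_notMem_stopSet (hxS : x ∉ S.stopSet) : S.value x =
    S.obsCost + min (B.expect S.value x) (B.expect S.value (S.reset x)) := by
  have heq := S.value_eq_min hx
  rcases min_choice (S.stopCost x)
    (S.obsCost + min (B.expect S.value x) (B.expect S.value (S.reset x))) with h | h
  · exact absurd ⟨hx, (heq.trans h).symm⟩ hxS
  · exact heq.trans h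

end StoppingProblem

end BayesFilter

/-- The sets `F i` are measurable, pairwise disjoint and cover `P`-almost every point. -/
structure IsAEPartition {Ω ι : Type*} [MeasurableSpace Ω] (P : Measure Ω) (F : ι → Set Ω) :
    Prop where
  measurableSet : ∀ i, MeasurableSet (F i)
  disjoint : Pairwise (Function.onFun Disjoint F)
  ae_mem : ∀ᵐ ω ∂P, ω ∈ ⋃ i, F i

namespace IsAEPartition

variable {Ω ι : Type*} [MeasurableSpace Ω] {P : Measure Ω}

theorem fiber [MeasurableSpace ι] [MeasurableSingletonClass ι] {N : Ω → ι} (hN : Measurable N) :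
    IsAEPartition P fun i => N ⁻¹' {i} where
  measurableSet i := hN (measurableSet_singleton i)
  disjoint _ _ hij := disjoint_left.2 fun _ hi hj => hij (hi.symm.trans hj)
  ae_mem := ae_of_all _ fun ω => mem_iUnion.2 ⟨N ω, rfl⟩

theorem of_ae_ne_top {τ : Ω → WithTop ℕ} (hτ : Measurable τ) (hfin : ∀ᵐ ω ∂P, τ ω ≠ ⊤) :
    IsAEPartition P fun n : ℕ => {ω | τ ω = n} where
  measurableSet _ := hτ (measurableSet_singleton _)
  disjoint i j hij := disjoint_left.2 fun ω (hi : τ ω = i) (hj : τ ω = j) =>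
    hij (WithTop.coe_injective (hi.symm.trans hj))
  ae_mem := by
    filter_upwards [hfin] with ω hω
    obtain ⟨n, hn⟩ := WithTop.ne_top_iff_exists.1 hω
    exact mem_iUnion.2 ⟨n, hn.symm⟩

variable [Countable ι] {F : ι → Set Ω} (hF : IsAEPartition P F) {A : Set Ω} (hA : MeasurableSet A)

include hF hA

theorem setLIntegral_eq_tsum (f : Ω → ℝ≥0∞) :
    ∫⁻ ω in A, f ω ∂P = ∑' i, ∫⁻ ω in A ∩ F i, f ω ∂P := by
  rw [← lintegral_iUnion (fun i => hA.inter (hF.measurableSet i)) fun i j hij =>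
    (hF.disjoint hij).mono inter_subset_right inter_subset_right, ← inter_iUnion]
  refine setLIntegral_congr ?_
  filter_upwards [hF.ae_mem] with ω hω
  exact propext (and_iff_left hω).symm

theorem measure_eq_tsum : P A = ∑' i, P (A ∩ F i) := by
  simpa only [setLIntegral_one] using hF.setLIntegral_eq_tsum hA fun _ => 1

end IsAEPartition

section StoppedCost

theorem toENNReal_eq_tsum_ite (x : WithTop ℕ) :
    ENat.toENNReal x = ∑' k : ℕ, if (k : WithTop ℕ) < x then 1 else 0 := by
  cases x with
  | top =>
    simp only [Nat.cast_withTop, WithTop.coe_lt_top, if_true]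
    rw [ENNReal.tsum_const_eq_top_of_ne_zero one_ne_zero]
    rfl
  | coe n =>
    simp only [Nat.cast_withTop, WithTop.coe_lt_coe]
    rw [tsum_eq_sum (s := Finset.range n) fun k hk => if_neg (mt Finset.mem_range.2 hk),
      Finset.sum_congr rfl fun k hk => if_pos (Finset.mem_range.1 hk), Finset.sum_const,
      Finset.card_range, nsmul_one]
    rfl

variable {Ω : Type*} [MeasurableSpace Ω] {P : Measure Ω} {τ : Ω → WithTop ℕ}

/-- The expected cost of stopping at `min τ n`, when a step costs `C` and stopping at time `k`
costs `u k`. -/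
def truncatedCost (P : Measure Ω) (τ : Ω → WithTop ℕ) (C : ℝ≥0∞) (u : ℕ → Ω → ℝ≥0∞) (n : ℕ) :
    ℝ≥0∞ :=
  ∑ k ∈ Finset.range n,
      (C * P {ω | (k : WithTop ℕ) < τ ω} + ∫⁻ ω in {ω | τ ω = k}, u k ω ∂P) +
    ∫⁻ ω in {ω | (n : WithTop ℕ) ≤ τ ω}, u n ω ∂P

variable {C : ℝ≥0∞} {u : ℕ → Ω → ℝ≥0∞}

theorem truncatedCost_zero : truncatedCost P τ C u 0 = ∫⁻ ω, u 0 ω ∂P := by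
  simp [truncatedCost]

theorem truncatedCost_succ (n : ℕ) : truncatedCost P τ C u (n + 1) =
    ∑ k ∈ Finset.range n,
        (C * P {ω | (k : WithTop ℕ) < τ ω} + ∫⁻ ω in {ω | τ ω = k}, u k ω ∂P) +
      ∫⁻ ω in {ω | τ ω = n}, u n ω ∂P + (C * P {ω | (n : WithTop ℕ) < τ ω} +
        ∫⁻ ω in {ω | (n : WithTop ℕ) < τ ω}, u (n + 1) ω ∂P) := by
  have hset : {ω | ((n + 1 : ℕ) : WithTop ℕ) ≤ τ ω} = {ω | (n : WithTop ℕ) < τ ω} :=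
    ext fun ω => ENat.add_one_le_iff (ENat.natCast_ne_top n)
  rw [truncatedCost, Finset.sum_range_succ, hset]
  ring

variable (hτ : Measurable τ)

include hτ

theorem measurable_toENNReal_comp : Measurable fun ω => ENat.toENNReal (τ ω) :=
  (WithTop.measurable_of_measurable_comp_coe
    (measurable_of_countable fun n : ℕ => ENat.toENNReal n)).comp hτ

theorem lintegral_toENNReal_eq_tsum :
    ∫⁻ ω, ENat.toENNReal (τ ω) ∂P = ∑' k : ℕ, P {ω | (k : WithTop ℕ) < τ ω} := by
  have hlt : ∀ k : ℕ, MeasurableSet {ω | (k : WithTop ℕ) < τ ω} := fun k => hτ measurableSet_Ioi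
  simp_rw [toENNReal_eq_tsum_ite]
  rw [lintegral_tsum fun k =>
    (Measurable.ite (hlt k) measurable_const measurable_const).aemeasurable]
  refine tsum_congr fun k => (lintegral_congr fun ω => ?_).trans (lintegral_indicator_one (hlt k))
  simp only [indicator_apply, mem_ofPred_eq, Pi.one_apply]

theorem lintegral_toENNReal_add (σ : Ω → WithTop ℕ) :
    ∫⁻ ω, ENat.toENNReal (τ ω + σ ω) ∂P =
      ∫⁻ ω, ENat.toENNReal (τ ω) ∂P + ∫⁻ ω, ENat.toENNReal (σ ω) ∂P := by
  rw [← lintegral_add_left (measurable_toENNReal_comp hτ)]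
  exact lintegral_congr fun ω => ENat.toENNReal_add _ _

theorem ae_ne_top_of_lintegral_ne_top (h : ∫⁻ ω, ENat.toENNReal (τ ω) ∂P ≠ ∞) :
    ∀ᵐ ω ∂P, τ ω ≠ ⊤ := by
  filter_upwards [ae_lt_top (measurable_toENNReal_comp hτ) h] with ω hω htop
  rw [htop] at hω
  exact hω.ne rfl

theorem truncatedCost_eq (n : ℕ) : truncatedCost P τ C u n =
    ∑ k ∈ Finset.range n,
        (C * P {ω | (k : WithTop ℕ) < τ ω} + ∫⁻ ω in {ω | τ ω = k}, u k ω ∂P) +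
      ∫⁻ ω in {ω | τ ω = n}, u n ω ∂P + ∫⁻ ω in {ω | (n : WithTop ℕ) < τ ω}, u n ω ∂P := by
  have hset : {ω | (n : WithTop ℕ) ≤ τ ω} = {ω | τ ω = n} ∪ {ω | (n : WithTop ℕ) < τ ω} := by
    ext ω
    exact (le_iff_eq_or_lt (a := (n : WithTop ℕ))).trans (or_congr_left eq_comm)
  have hdisj : Disjoint {ω | τ ω = n} {ω | (n : WithTop ℕ) < τ ω} :=
    disjoint_left.2 fun ω (heq : τ ω = n) (hlt : (n : WithTop ℕ) < τ ω) => hlt.ne' heq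
  have hlt : MeasurableSet {ω | (n : WithTop ℕ) < τ ω} := hτ measurableSet_Ioi
  rw [truncatedCost, hset, lintegral_union hlt hdisj, add_assoc]

theorem tsum_eq_cost_of_ae_ne_top (hfin : ∀ᵐ ω ∂P, τ ω ≠ ⊤) :
    ∑' k : ℕ, (C * P {ω | (k : WithTop ℕ) < τ ω} + ∫⁻ ω in {ω | τ ω = k}, u k ω ∂P) =
      C * ∫⁻ ω, ENat.toENNReal (τ ω) ∂P + ∫⁻ ω, u ((τ ω).untopD 0) ω ∂P := by
  have hpart := IsAEPartition.of_ae_ne_top hτ hfin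
  rw [ENNReal.tsum_add, ENNReal.tsum_mul_left, lintegral_toENNReal_eq_tsum hτ,
    ← setLIntegral_univ (fun ω => u ((τ ω).untopD 0) ω),
    hpart.setLIntegral_eq_tsum MeasurableSet.univ]
  simp only [univ_inter]
  congr 2 with k
  refine setLIntegral_congr_fun (hpart.measurableSet k) fun ω (hω : τ ω = k) => ?_
  simp only [hω, Nat.cast_withTop, WithTop.untopD_coe]

theorem tendsto_measure_le_atTop [IsFiniteMeasure P] (hfin : ∀ᵐ ω ∂P, τ ω ≠ ⊤) :
    Tendsto (fun n : ℕ => P {ω | (n : WithTop ℕ) ≤ τ ω}) atTop (𝓝 0) := by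
  have hInter : P (⋂ n : ℕ, {ω | (n : WithTop ℕ) ≤ τ ω}) = 0 := by
    refine measure_mono_null (t := {ω | τ ω ≠ ⊤}ᶜ) (fun ω hω hne => ?_) hfin
    obtain ⟨n, hn⟩ := WithTop.ne_top_iff_exists.1 hne
    have hle : ((n + 1 : ℕ) : WithTop ℕ) ≤ n := (mem_iInter.1 hω (n + 1)).trans_eq hn.symm
    exact absurd (WithTop.coe_le_coe.1 hle) n.lt_succ_self.not_ge
  rw [← hInter]
  exact tendsto_measure_iInter_atTop (fun n => (hτ measurableSet_Ici).nullMeasurableSet)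
    (fun i j hij ω hω => (WithTop.coe_le_coe.2 hij).trans hω) ⟨0, measure_ne_top _ _⟩

theorem lintegral_le_stopped [IsFiniteMeasure P] (hC : C ≠ 0) (hu : ∀ k ω, u k ω ≤ 1)
    (hstep : ∀ k : ℕ, ∫⁻ ω in {ω | (k : WithTop ℕ) < τ ω}, u k ω ∂P ≤
      C * P {ω | (k : WithTop ℕ) < τ ω} +
        ∫⁻ ω in {ω | (k : WithTop ℕ) < τ ω}, u (k + 1) ω ∂P) :
    ∫⁻ ω, u 0 ω ∂P ≤
      C * ∫⁻ ω, ENat.toENNReal (τ ω) ∂P + ∫⁻ ω, u ((τ ω).untopD 0) ω ∂P := by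
  by_cases htop : ∫⁻ ω, ENat.toENNReal (τ ω) ∂P = ∞
  · simp [htop, ENNReal.mul_top hC]
  have hfin := ae_ne_top_of_lintegral_ne_top hτ htop
  have hmono : Monotone (truncatedCost P τ C u) := monotone_nat_of_le_succ fun n => by
    rw [truncatedCost_eq hτ, truncatedCost_succ]
    gcongr
    exact hstep n
  rw [← tsum_eq_cost_of_ae_ne_top hτ hfin]
  have hbound : ∀ n : ℕ, ∫⁻ ω, u 0 ω ∂P ≤ ∑' k : ℕ, (C * P {ω | (k : WithTop ℕ) < τ ω} +
      ∫⁻ ω in {ω | τ ω = k}, u k ω ∂P) + P {ω | (n : WithTop ℕ) ≤ τ ω} := fun n => by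
    rw [← truncatedCost_zero (τ := τ) (C := C)]
    refine (hmono n.zero_le).trans (add_le_add (ENNReal.sum_le_tsum _) ?_)
    exact (lintegral_mono fun ω => hu n ω).trans_eq (setLIntegral_one _)
  simpa only [add_zero] using ge_of_tendsto
    (tendsto_const_nhds.add (tendsto_measure_le_atTop hτ hfin)) (Eventually.of_forall hbound)

theorem stopped_le_lintegral [IsProbabilityMeasure P] (hC : C ≠ 0) (hu : ∀ ω, u 0 ω ≤ 1)
    (hstep : ∀ k : ℕ, C * P {ω | (k : WithTop ℕ) < τ ω} +
      ∫⁻ ω in {ω | (k : WithTop ℕ) < τ ω}, u (k + 1) ω ∂P ≤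
        ∫⁻ ω in {ω | (k : WithTop ℕ) < τ ω}, u k ω ∂P) :
    (∀ᵐ ω ∂P, τ ω ≠ ⊤) ∧ C * ∫⁻ ω, ENat.toENNReal (τ ω) ∂P +
      ∫⁻ ω, u ((τ ω).untopD 0) ω ∂P ≤ ∫⁻ ω, u 0 ω ∂P := by
  have hanti : Antitone (truncatedCost P τ C u) := antitone_nat_of_succ_le fun n => by
    rw [truncatedCost_succ, truncatedCost_eq hτ]
    gcongr
    exact hstep n
  have hle : ∑' k : ℕ, (C * P {ω | (k : WithTop ℕ) < τ ω} +
      ∫⁻ ω in {ω | τ ω = k}, u k ω ∂P) ≤ ∫⁻ ω, u 0 ω ∂P :=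
    ENNReal.tsum_le_of_sum_range_le fun n =>
      le_self_add.trans ((hanti n.zero_le).trans_eq truncatedCost_zero)
  have hu1 : ∫⁻ ω, u 0 ω ∂P ≤ 1 := (lintegral_mono hu).trans (by simp)
  have hfin : ∀ᵐ ω ∂P, τ ω ≠ ⊤ := by
    refine ae_ne_top_of_lintegral_ne_top hτ fun htop => ?_
    rw [lintegral_toENNReal_eq_tsum hτ] at htop
    have hle1 := hle.trans hu1
    rw [ENNReal.tsum_add, ENNReal.tsum_mul_left, htop, ENNReal.mul_top hC, top_add] at hle1
    exact absurd hle1 (by simp)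
  exact ⟨hfin, (tsum_eq_cost_of_ae_ne_top hτ hfin).symm.trans_le hle⟩

end StoppedCost

section Stopped

variable {Ω X : Type*} {mΩ : MeasurableSpace Ω} [MeasurableSpace X] {f : Filtration ℕ mΩ}
  {τ : Ω → WithTop ℕ}

theorem measurableSet_inter_eq_top (hτ : IsStoppingTime f τ) {A : Set Ω}
    (hA : MeasurableSet[⨆ k, f k] A) :
    MeasurableSet[hτ.measurableSpace] (A ∩ {ω | τ ω = ⊤}) := by
  have hle : ∀ k : ℕ, A ∩ {ω | τ ω = ⊤} ∩ {ω | τ ω ≤ WithTop.some k} = ∅ := fun k =>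
    eq_empty_of_forall_notMem fun ω ⟨⟨_, htop⟩, hk⟩ =>
      (WithTop.coe_lt_top k).not_ge (htop.symm.trans_le hk)
  refine (hτ.measurableSet _).2 ⟨MeasurableSet.inter hA hτ.measurableSet_eq_top', fun k => ?_⟩
  exact (hle k).symm ▸ @MeasurableSet.empty Ω (f k)

theorem measurable_stopped (hτ : IsStoppingTime f τ) {u : ℕ → Ω → X}
    (hu : ∀ k, Measurable[f k] (u k)) :
    Measurable[hτ.measurableSpace] fun ω => u ((τ ω).untopD 0) ω := by
  intro C hC
  have hunion : (fun ω => u ((τ ω).untopD 0) ω) ⁻¹' C =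
      ⋃ t : WithTop ℕ, u (t.untopD 0) ⁻¹' C ∩ {ω | τ ω = t} := by
    ext ω
    simp
  rw [hunion]
  refine MeasurableSet.iUnion fun t => ?_
  cases t with
  | top => exact measurableSet_inter_eq_top hτ (le_iSup (fun k => f k) 0 _ (hu 0 hC))
  | coe n =>
    exact (hτ.measurableSet_inter_eq_iff _ n).2
      (MeasurableSet.inter (hu n hC) (hτ.measurableSet_eq n))

end Stopped

theorem measurable_apply_index {Ω ι X : Type*} [MeasurableSpace Ω] [MeasurableSpace ι] [Countable ι]
    [MeasurableSingletonClass ι] [MeasurableSpace X] {N : Ω → ι} (hN : Measurable N)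
    {u : ι → Ω → X} (hu : ∀ i, Measurable (u i)) : Measurable fun ω => u (N ω) ω := by
  have h : Measurable (Function.uncurry u) := measurable_from_prod_countable_right hu
  exact h.comp (hN.prodMk measurable_id)

theorem measure_eq_of_sup {Ω : Type*} {m₁ m₂ mΩ : MeasurableSpace Ω} (h₁ : m₁ ≤ mΩ) (h₂ : m₂ ≤ mΩ)
    {μ ν : Measure Ω} [IsFiniteMeasure μ]
    (h : ∀ A B, MeasurableSet[m₁] A → MeasurableSet[m₂] B → μ (A ∩ B) = ν (A ∩ B))
    {A : Set Ω} (hA : MeasurableSet[m₁ ⊔ m₂] A) : μ A = ν A := by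
  refine ext_on_measurableSpace_of_generate_finite mΩ (μ := μ) (ν := ν)
    (image2 (· ∩ ·) {A | MeasurableSet[m₁] A} {B | MeasurableSet[m₂] B}) ?_ (sup_le h₁ h₂)
    (le_antisymm (sup_le ?_ ?_) (MeasurableSpace.generateFrom_le ?_)) ?_ ?_ hA
  · rintro _ ⟨A, hA, B, hB, rfl⟩
    exact h A B hA hB
  · exact fun A hA => MeasurableSpace.measurableSet_generateFrom
      ⟨A, hA, univ, MeasurableSet.univ, inter_univ A⟩
  · exact fun A hA => MeasurableSpace.measurableSet_generateFrom
      ⟨univ, MeasurableSet.univ, A, hA, univ_inter A⟩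
  · rintro _ ⟨A, hA, B, hB, rfl⟩
    exact MeasurableSet.inter (le_sup_left (a := m₁) (b := m₂) A hA)
      (le_sup_right (a := m₁) (b := m₂) B hB)
  · rintro _ ⟨A, hA, B, hB, rfl⟩ _ ⟨A', hA', B', hB', rfl⟩ -
    exact ⟨A ∩ A', MeasurableSet.inter hA hA', B ∩ B', MeasurableSet.inter hB hB',
      (inter_inter_inter_comm A B A' B').symm⟩
  · simpa only [inter_univ] using h univ univ MeasurableSet.univ MeasurableSet.univ

theorem lintegral_congr_measure_of_measurable {Ω : Type*} {m mΩ : MeasurableSpace Ω} (hm : m ≤ mΩ)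
    {μ ν : Measure Ω} (h : ∀ A, MeasurableSet[m] A → μ A = ν A) {φ : Ω → ℝ≥0∞}
    (hφ : Measurable[m] φ) : ∫⁻ ω, φ ω ∂μ = ∫⁻ ω, φ ω ∂ν := by
  have htrim : μ.trim hm = ν.trim hm := @Measure.ext Ω m _ _ fun A hA => by
    rw [trim_measurableSet_eq hm hA, trim_measurableSet_eq hm hA, h A hA]
  rw [← lintegral_trim hm hφ, ← lintegral_trim hm hφ, htrim]

/-- The weights `w` are a version of the conditional probabilities of the values of `θ` given
`m`. Measurability of `w` with respect to `m` is not part of this notion. -/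
def IsPosterior {Ω Θ : Type*} (m : MeasurableSpace Ω) {_ : MeasurableSpace Ω} (P : Measure Ω)
    (θ : Ω → Θ) (w : Ω → Θ → ℝ) : Prop :=
  ∀ A, MeasurableSet[m] A → ∀ a, P (A ∩ θ ⁻¹' {a}) = ∫⁻ ω in A, ENNReal.ofReal (w ω a) ∂P

/-- Given `m`, the observation `x` has the law `μ a` on the event `θ = a`. -/
def HasCondLaw {Ω Θ E : Type*} [MeasurableSpace E] (m : MeasurableSpace Ω)
    {_ : MeasurableSpace Ω} (P : Measure Ω) (θ : Ω → Θ) (x : Ω → E) (μ : Θ → Measure E) : Prop :=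
  ∀ A C, MeasurableSet[m] A → MeasurableSet C → ∀ a,
    P (A ∩ θ ⁻¹' {a} ∩ x ⁻¹' C) = P (A ∩ θ ⁻¹' {a}) * μ a C

namespace HasCondLaw

variable {Ω Θ Θ' E X ι : Type*} [MeasurableSpace E] {m m' mΩ : MeasurableSpace Ω} {P : Measure Ω}
  {θ : Ω → Θ} {x : Ω → E} {μ : Θ → Measure E}

theorem mono (h : HasCondLaw m P θ x μ) (hm : m' ≤ m) : HasCondLaw m' P θ x μ :=
  fun A C hA hC a => h A C (hm A hA) hC a

theorem prodMk_left [MeasurableSpace Θ'] [MeasurableSingletonClass Θ']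
    (h : HasCondLaw m P θ x μ) {η : Ω → Θ'} (hη : Measurable[m] η) :
    HasCondLaw m P (fun ω => (θ ω, η ω)) x fun a => μ a.1 := by
  rintro A C hA hC ⟨a, b⟩
  have hset : A ∩ (fun ω => (θ ω, η ω)) ⁻¹' {(a, b)} = A ∩ η ⁻¹' {b} ∩ θ ⁻¹' {a} := by
    ext ω
    simp only [mem_inter_iff, mem_preimage, mem_singleton_iff, Prod.mk.injEq]
    tauto
  rw [hset]
  exact h _ C (MeasurableSet.inter hA (hη (measurableSet_singleton b))) hC a

theorem sup_of_indep [IsFiniteMeasure P] [MeasurableSpace Θ] [MeasurableSingletonClass Θ]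
    (h : HasCondLaw m P θ x μ) (hmm' : m ≤ m') (hθ : Measurable[m'] θ) (hx : Measurable[m'] x)
    {n : MeasurableSpace Ω} (hind : Indep m' n P) (hm' : m' ≤ mΩ) (hn : n ≤ mΩ) :
    HasCondLaw (m ⊔ n) P θ x μ := by
  intro A C hA hC a
  have hθa : MeasurableSet[m'] (θ ⁻¹' {a}) := hθ (measurableSet_singleton a)
  have hθx : MeasurableSet[m'] (θ ⁻¹' {a} ∩ x ⁻¹' C) := MeasurableSet.inter hθa (hx hC)
  have hprod : ∀ A B S, MeasurableSet[m] A → MeasurableSet[n] B → MeasurableSet[m'] S →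
      P (A ∩ B ∩ S) = P (A ∩ S) * P B := fun A B S hA hB hS => by
    rw [inter_right_comm]
    exact (Indep_iff m' n P).1 hind _ _ (MeasurableSet.inter (hmm' A hA) hS) hB
  have hsup := measure_eq_of_sup (μ := P.restrict (θ ⁻¹' {a} ∩ x ⁻¹' C))
    (ν := μ a C • P.restrict (θ ⁻¹' {a})) (hmm'.trans hm') hn (fun A B hA hB => by
      rw [Measure.smul_apply, Measure.restrict_apply' (hm' _ hθx),
        Measure.restrict_apply' (hm' _ hθa), hprod A B _ hA hB hθx, hprod A B _ hA hB hθa,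
        ← inter_assoc, h A C hA hC a, smul_eq_mul]
      ring) hA
  rwa [Measure.smul_apply, Measure.restrict_apply' (hm' _ hθx),
    Measure.restrict_apply' (hm' _ hθa), ← inter_assoc, smul_eq_mul, mul_comm] at hsup

theorem setLIntegral [IsFiniteMeasure P] [∀ a, SigmaFinite (μ a)] [MeasurableSpace X]
    (h : HasCondLaw m P θ x μ) (hm : m ≤ mΩ) (hx : Measurable x) {q : Ω → X}
    (hq : Measurable[m] q) {F : X × E → ℝ≥0∞} (hF : Measurable F) {A : Set Ω}
    (hA : MeasurableSet[m] A) (a : Θ) : ∫⁻ ω in A ∩ θ ⁻¹' {a}, F (q ω, x ω) ∂P =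
      ∫⁻ ω in A ∩ θ ⁻¹' {a}, ∫⁻ z, F (q ω, z) ∂μ a ∂P := by
  have hq' : Measurable q := hq.mono hm le_rfl
  have hprod : ((P.restrict (A ∩ θ ⁻¹' {a})).map q).prod (μ a) =
      (P.restrict (A ∩ θ ⁻¹' {a})).map fun ω => (q ω, x ω) :=
    Measure.prod_eq fun D C hD hC => by
      have hAD := h (A ∩ q ⁻¹' D) C (MeasurableSet.inter hA (hq hD)) hC a
      rw [Measure.map_apply hq' hD, Measure.map_apply (hq'.prodMk hx) (hD.prod hC),
        Measure.restrict_apply (hq' hD), Measure.restrict_apply ((hq'.prodMk hx) (hD.prod hC))]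
      convert hAD using 2
      · ext ω
        simp only [mem_inter_iff, mem_preimage, mem_prod]
        tauto
      · rw [inter_comm, inter_right_comm]
  rw [← lintegral_map hF (hq'.prodMk hx), ← hprod, lintegral_prod _ hF.aemeasurable,
    lintegral_map hF.lintegral_prod_right' hq']

theorem add [IsFiniteMeasure P] [AddMonoid E] [MeasurableAdd₂ E] [MeasurableSpace Θ]
    [MeasurableSingletonClass Θ] [MeasurableSpace Θ'] [MeasurableSingletonClass Θ']
    {η : Ω → Θ'} {y : Ω → E} {ν : Θ' → Measure E} [∀ a, SigmaFinite (μ a)]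
    [∀ b, SigmaFinite (ν b)] (h : HasCondLaw m P θ x μ) (h' : HasCondLaw m' P η y ν)
    (hmm' : m ≤ m') (hm' : m' ≤ mΩ) (hθ : Measurable[m'] θ) (hx : Measurable[m'] x)
    (hη : Measurable[m] η) (hy : Measurable y) :
    HasCondLaw m P (fun ω => (θ ω, η ω)) (fun ω => x ω + y ω) fun a => (μ a.1).conv (ν a.2) := by
  rintro A C hA hC ⟨a, b⟩
  have hx' : Measurable x := hx.mono hm' le_rfl
  have hxyC : MeasurableSet ((fun ω => x ω + y ω) ⁻¹' C) := (hx'.add hy) hC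
  have hAθ : MeasurableSet[m'] (A ∩ θ ⁻¹' {a}) :=
    MeasurableSet.inter (hmm' A hA) (hθ (measurableSet_singleton a))
  have hAη : MeasurableSet[m] (A ∩ η ⁻¹' {b}) :=
    MeasurableSet.inter hA (hη (measurableSet_singleton b))
  have hset : A ∩ (fun ω => (θ ω, η ω)) ⁻¹' {(a, b)} = A ∩ θ ⁻¹' {a} ∩ η ⁻¹' {b} := by
    ext ω
    simp only [mem_inter_iff, mem_preimage, mem_singleton_iff, Prod.mk.injEq, and_assoc]
  have hF : Measurable fun z : E × E => C.indicator (1 : E → ℝ≥0∞) (z.1 + z.2) :=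
    (measurable_one.indicator hC).comp measurable_add
  calc P (A ∩ (fun ω => (θ ω, η ω)) ⁻¹' {(a, b)} ∩ (fun ω => x ω + y ω) ⁻¹' C)
    _ = ∫⁻ ω in A ∩ θ ⁻¹' {a} ∩ η ⁻¹' {b}, C.indicator 1 (x ω + y ω) ∂P := by
      rw [hset, inter_comm, ← Measure.restrict_apply hxyC, ← lintegral_indicator_one hxyC]
      rfl
    _ = ∫⁻ ω in A ∩ θ ⁻¹' {a} ∩ η ⁻¹' {b}, ∫⁻ z, C.indicator 1 (x ω + z) ∂ν b ∂P :=
      h'.setLIntegral hm' hy hx hF hAθ b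
    _ = ∫⁻ _ in A ∩ η ⁻¹' {b} ∩ θ ⁻¹' {a}, ∫⁻ t, ∫⁻ z, C.indicator 1 (t + z) ∂ν b ∂μ a ∂P := by
      rw [inter_right_comm]
      exact h.setLIntegral (hmm'.trans hm') hx' (measurable_const (a := ()))
        (hF.lintegral_prod_right'.comp measurable_snd) hAη a
    _ = P (A ∩ (fun ω => (θ ω, η ω)) ⁻¹' {(a, b)}) * (μ a).conv (ν b) C := by
      rw [setLIntegral_const, hset, inter_right_comm, ← lintegral_indicator_one hC,
        Measure.lintegral_conv (measurable_one.indicator hC), mul_comm]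

theorem of_partition [Countable ι] [MeasurableSpace Θ] [MeasurableSingletonClass Θ]
    {F : ι → Set Ω} (hF : IsAEPartition P F) (hm : m ≤ mΩ) {m' : ι → MeasurableSpace Ω}
    (hmF : ∀ i A, MeasurableSet[m] A → MeasurableSet[m' i] (A ∩ F i)) (hθ : Measurable θ)
    (hx : Measurable x) {θ' : ι → Ω → Θ} (hθ' : ∀ i, EqOn θ (θ' i) (F i)) {x' : ι → Ω → E}
    (hx' : ∀ i, EqOn x (x' i) (F i)) (h : ∀ i, HasCondLaw (m' i) P (θ' i) (x' i) μ) :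
    HasCondLaw m P θ x μ := by
  intro A C hA hC a
  have hAθ : MeasurableSet (A ∩ θ ⁻¹' {a}) := (hm A hA).inter (hθ (measurableSet_singleton a))
  have hθF : ∀ i, A ∩ θ ⁻¹' {a} ∩ F i = A ∩ F i ∩ θ' i ⁻¹' {a} := fun i => by
    ext ω
    simp only [mem_inter_iff, mem_preimage, mem_singleton_iff, and_right_comm (c := ω ∈ F i)]
    exact and_congr_right fun hω => by rw [hθ' i hω.2]
  have hxF : ∀ i, A ∩ θ ⁻¹' {a} ∩ x ⁻¹' C ∩ F i = A ∩ F i ∩ θ' i ⁻¹' {a} ∩ x' i ⁻¹' C :=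
    fun i => by
      rw [inter_right_comm, hθF]
      ext ω
      exact and_congr_right fun hω => by rw [mem_preimage, mem_preimage, hx' i hω.1.2]
  rw [hF.measure_eq_tsum (hAθ.inter (hx hC)), hF.measure_eq_tsum hAθ, ← ENNReal.tsum_mul_right]
  simp_rw [hxF, hθF]
  exact tsum_congr fun i => h i _ C (hmF i A hA) hC a

theorem comp_index [Countable ι] [MeasurableSpace ι] [MeasurableSingletonClass ι]
    [MeasurableSpace Θ] [MeasurableSingletonClass Θ] {θ : ι → Ω → Θ} {x : ι → Ω → E}
    (hm : m ≤ mΩ) {N : Ω → ι} (hN : Measurable[m] N) (hθ : ∀ i, Measurable (θ i))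
    (hx : ∀ i, Measurable (x i)) (h : ∀ i, HasCondLaw m P (θ i) (x i) μ) :
    HasCondLaw m P (fun ω => θ (N ω) ω) (fun ω => x (N ω) ω) μ := by
  have hN' : Measurable N := hN.mono hm le_rfl
  refine of_partition (IsAEPartition.fiber hN') hm (m' := fun _ => m)
    (fun i A hA => MeasurableSet.inter hA (hN (measurableSet_singleton i)))
    (measurable_apply_index hN' hθ) (measurable_apply_index hN' hx)
    (fun i ω (hω : N ω = i) => ?_) (fun i ω (hω : N ω = i) => ?_) h
  all_goals rw [hω]

end HasCondLaw

namespace IsPosterior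

variable {Ω Θ ι : Type*} {m mΩ : MeasurableSpace Ω} {P : Measure Ω} {θ : Ω → Θ} {w : Ω → Θ → ℝ}

theorem setLIntegral (h : IsPosterior m P θ w) (hm : m ≤ mΩ)
    (hw : ∀ a, Measurable[m] fun ω => w ω a) {φ : Ω → ℝ≥0∞} (hφ : Measurable[m] φ)
    {A : Set Ω} (hA : MeasurableSet[m] A) (a : Θ) :
    ∫⁻ ω in A ∩ θ ⁻¹' {a}, φ ω ∂P = ∫⁻ ω in A, φ ω * ENNReal.ofReal (w ω a) ∂P := by
  have hw' : Measurable fun ω => ENNReal.ofReal (w ω a) :=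
    ((hw a).mono hm le_rfl).ennreal_ofReal
  have hmeasure : ∀ D, MeasurableSet[m] D → P.restrict (A ∩ θ ⁻¹' {a}) D =
      (P.withDensity fun ω => ENNReal.ofReal (w ω a)).restrict A D := fun D hD => by
    rw [Measure.restrict_apply (hm D hD), Measure.restrict_apply (hm D hD),
      withDensity_apply _ ((hm D hD).inter (hm A hA)), ← inter_assoc,
      h _ (MeasurableSet.inter hD hA) a]
  rw [lintegral_congr_measure_of_measurable hm hmeasure hφ,
    restrict_withDensity (hm A hA),
    lintegral_withDensity_eq_lintegral_mul _ hw' (hφ.mono hm le_rfl)]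
  exact lintegral_congr fun ω => mul_comm _ _

theorem measure_inter_mem [Countable Θ] [MeasurableSpace Θ] [MeasurableSingletonClass Θ]
    (h : IsPosterior m P θ w) (hm : m ≤ mΩ) (hθ : Measurable θ)
    (hw : ∀ a, Measurable[m] fun ω => w ω a) {D : Ω → Finset Θ}
    (hD : ∀ a, MeasurableSet[m] {ω | a ∈ D ω}) {A : Set Ω} (hA : MeasurableSet[m] A) :
    P (A ∩ {ω | θ ω ∈ D ω}) = ∫⁻ ω in A, ∑ a ∈ D ω, ENNReal.ofReal (w ω a) ∂P := by
  have hAD : ∀ a, MeasurableSet[m] (A ∩ {ω | a ∈ D ω}) := fun a => MeasurableSet.inter hA (hD a)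
  have hfiber : ∀ a, A ∩ {ω | θ ω ∈ D ω} ∩ θ ⁻¹' {a} = A ∩ {ω | a ∈ D ω} ∩ θ ⁻¹' {a} := fun a => by
    ext ω
    simp only [mem_inter_iff, mem_ofPred_eq, mem_preimage, mem_singleton_iff]
    exact and_congr_left fun hω => by rw [hω]
  have hmem : MeasurableSet (A ∩ {ω | θ ω ∈ D ω}) := by
    have hunion : A ∩ {ω | θ ω ∈ D ω} = ⋃ a, A ∩ {ω | a ∈ D ω} ∩ θ ⁻¹' {a} := by
      ext ω
      simp
    rw [hunion]
    exact MeasurableSet.iUnion fun a => (hm _ (hAD a)).inter (hθ (measurableSet_singleton a))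
  calc P (A ∩ {ω | θ ω ∈ D ω})
    _ = ∑' a, P (A ∩ {ω | a ∈ D ω} ∩ θ ⁻¹' {a}) := by
      rw [(IsAEPartition.fiber hθ).measure_eq_tsum hmem]
      simp_rw [hfiber]
    _ = ∑' a, ∫⁻ ω in A, {ω | a ∈ D ω}.indicator (fun ω => ENNReal.ofReal (w ω a)) ω ∂P :=
      tsum_congr fun a => by
        rw [h _ (hAD a) a, inter_comm, lintegral_indicator (hm _ (hD a)),
          Measure.restrict_restrict (hm _ (hD a))]
    _ = ∫⁻ ω in A, ∑' a, {ω | a ∈ D ω}.indicator (fun ω => ENNReal.ofReal (w ω a)) ω ∂P :=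
      (lintegral_tsum fun a =>
        (((hw a).mono hm le_rfl).ennreal_ofReal.indicator (hm _ (hD a))).aemeasurable).symm
    _ = ∫⁻ ω in A, ∑ a ∈ D ω, ENNReal.ofReal (w ω a) ∂P := by
      refine lintegral_congr fun ω => ?_
      rw [tsum_eq_sum (s := D ω) fun a ha => indicator_of_notMem (s := {ω | a ∈ D ω}) ha _]
      exact Finset.sum_congr rfl fun a ha => indicator_of_mem (s := {ω | a ∈ D ω}) ha _

theorem of_partition [Countable ι] [MeasurableSpace Θ] [MeasurableSingletonClass Θ]
    {F : ι → Set Ω} (hF : IsAEPartition P F) (hm : m ≤ mΩ) {m' : ι → MeasurableSpace Ω}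
    (hmF : ∀ i A, MeasurableSet[m] A → MeasurableSet[m' i] (A ∩ F i)) (hθ : Measurable θ)
    {θ' : ι → Ω → Θ} (hθ' : ∀ i, EqOn θ (θ' i) (F i)) {w' : ι → Ω → Θ → ℝ}
    (hw' : ∀ i, EqOn w (w' i) (F i)) (h : ∀ i, IsPosterior (m' i) P (θ' i) (w' i)) :
    IsPosterior m P θ w := by
  intro A hA a
  have hθF : ∀ i, A ∩ θ ⁻¹' {a} ∩ F i = A ∩ F i ∩ θ' i ⁻¹' {a} := fun i => by
    ext ω
    simp only [mem_inter_iff, mem_preimage, mem_singleton_iff, and_right_comm (c := ω ∈ F i)]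
    exact and_congr_right fun hω => by rw [hθ' i hω.2]
  rw [hF.measure_eq_tsum ((hm A hA).inter (hθ (measurableSet_singleton a))),
    hF.setLIntegral_eq_tsum (hm A hA)]
  refine tsum_congr fun i => ?_
  rw [hθF, h i _ (hmF i A hA) a]
  exact setLIntegral_congr_fun ((hm A hA).inter (hF.measurableSet i)) fun ω hω => by
    rw [hw' i hω.2]

theorem stopped [MeasurableSpace Θ] [MeasurableSingletonClass Θ] {f : Filtration ℕ mΩ}
    {τ : Ω → WithTop ℕ} (hτ : IsStoppingTime f τ) (hfin : ∀ᵐ ω ∂P, τ ω ≠ ⊤) {θ : ℕ → Ω → Θ}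
    {w : ℕ → Ω → Θ → ℝ} (hθ : ∀ k, Measurable (θ k)) (h : ∀ k, IsPosterior (f k) P (θ k) (w k)) :
    IsPosterior hτ.measurableSpace P (fun ω => θ ((τ ω).untopD 0) ω)
      fun ω => w ((τ ω).untopD 0) ω := by
  refine of_partition (IsAEPartition.of_ae_ne_top hτ.measurable' hfin) hτ.measurableSpace_le
    (fun k A hA => (hτ.measurableSet_inter_eq_iff A k).1
      (MeasurableSet.inter hA (hτ.measurableSet_eq' k)))
    (measurable_apply_index (hτ.measurable'.untopD 0) hθ)
    (fun k ω (hω : τ ω = k) => ?_) (fun k ω (hω : τ ω = k) => ?_) h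
  all_goals simp only [hω, Nat.cast_withTop, WithTop.untopD_coe]

end IsPosterior

namespace BayesFilter

variable {Ω Θ X : Type*} [Fintype Θ] [MeasurableSpace Θ] [MeasurableSingletonClass Θ]
  [MeasurableSpace X] {B : BayesFilter Θ X} {m mΩ : MeasurableSpace Ω} {P : Measure Ω}
  [IsFiniteMeasure P] {θ : Ω → Θ} {q : Ω → X} {x : Ω → ℝ} (hm : m ≤ mΩ) (hθ : Measurable θ)
  (hx : Measurable x) (hq : Measurable[m] q) (hdom : ∀ ω, q ω ∈ B.dom)
  (hpost : IsPosterior m P θ fun ω => B.weight (q ω))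
  (hlaw : HasCondLaw m P θ x fun a => (B.obs a).law)

include hm hθ hx hq hdom hpost hlaw

theorem setLIntegral_observation {F : X × ℝ → ℝ≥0∞} (hF : Measurable F) {A : Set Ω}
    (hA : MeasurableSet[m] A) : ∫⁻ ω in A, F (q ω, x ω) ∂P =
      ∫⁻ ω in A, (∫⁻ z, F (q ω, z) * ENNReal.ofReal (B.density (q ω) z)) ∂P := by
  have hobs : ∀ a, Measurable fun y : X × ℝ => F y * ENNReal.ofReal ((B.obs a).f y.2) := fun a =>
    hF.mul ((B.obs a).measurable.comp measurable_snd).ennreal_ofReal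
  have hweight : ∀ a, Measurable[m] fun ω => B.weight (q ω) a := fun a =>
    (B.measurable_weight a).comp hq
  have hinner : ∀ a, Measurable[m] fun ω =>
      ∫⁻ z, F (q ω, z) * ENNReal.ofReal ((B.obs a).f z) := fun a =>
    (hobs a).lintegral_prod_right'.comp hq
  calc ∫⁻ ω in A, F (q ω, x ω) ∂P
    _ = ∑ a, ∫⁻ ω in A ∩ θ ⁻¹' {a}, F (q ω, x ω) ∂P := by
      rw [(IsAEPartition.fiber hθ).setLIntegral_eq_tsum (hm A hA), tsum_fintype]
    _ = ∑ a, ∫⁻ ω in A ∩ θ ⁻¹' {a},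
          (∫⁻ z, F (q ω, z) * ENNReal.ofReal ((B.obs a).f z)) ∂P := by
      refine Finset.sum_congr rfl fun a _ => (hlaw.setLIntegral hm hx hq hF hA a).trans ?_
      exact lintegral_congr fun ω => (B.obs a).lintegral_law (hF.comp measurable_prodMk_left)
    _ = ∑ a, ∫⁻ ω in A, (∫⁻ z, F (q ω, z) * ENNReal.ofReal ((B.obs a).f z)) *
          ENNReal.ofReal (B.weight (q ω) a) ∂P :=
      Finset.sum_congr rfl fun a _ => hpost.setLIntegral hm hweight (hinner a) hA a
    _ = ∫⁻ ω in A, ∑ a, (∫⁻ z, F (q ω, z) * ENNReal.ofReal ((B.obs a).f z)) *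
          ENNReal.ofReal (B.weight (q ω) a) ∂P :=
      (lintegral_finsetSum _ fun a _ => ((hinner a).mono hm le_rfl).mul
        ((hweight a).mono hm le_rfl).ennreal_ofReal).symm
    _ = ∫⁻ ω in A, (∫⁻ z, F (q ω, z) * ENNReal.ofReal (B.density (q ω) z)) ∂P := by
      refine lintegral_congr fun ω => ?_
      have hz : ∀ a, Measurable fun z => F (q ω, z) * ENNReal.ofReal ((B.obs a).f z) :=
        fun a => (hobs a).comp measurable_prodMk_left
      simp_rw [← lintegral_mul_const _ (hz _)]
      rw [← lintegral_finsetSum _ fun a _ => (hz a).mul_const _]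
      refine lintegral_congr fun z => ?_
      rw [ofReal_density (hdom ω), Finset.mul_sum]
      exact Finset.sum_congr rfl fun a _ => by ring

theorem isPosterior_update : IsPosterior (m ⊔ MeasurableSpace.comap x inferInstance) P θ
    fun ω => B.weight (B.update (q ω) (x ω)) := by
  intro A hA a
  have hθa : MeasurableSet (θ ⁻¹' {a}) := hθ (measurableSet_singleton a)
  have hweight : Measurable fun ω => ENNReal.ofReal (B.weight (q ω) a) :=
    (((B.measurable_weight a).comp hq).mono hm le_rfl).ennreal_ofReal
  rw [← Measure.restrict_apply' hθa, ← withDensity_apply _ (sup_le hm hx.comap_le A hA)]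
  refine measure_eq_of_sup hm hx.comap_le ?_ hA
  rintro D _ hD ⟨C, hC, rfl⟩
  have hF : Measurable fun y : X × ℝ =>
      C.indicator 1 y.2 * ENNReal.ofReal (B.weight (B.update y.1 y.2) a) :=
    ((measurable_one.indicator hC).comp measurable_snd).mul
      ((B.measurable_weight a).comp B.measurable_update).ennreal_ofReal
  calc P.restrict (θ ⁻¹' {a}) (D ∩ x ⁻¹' C)
    _ = ∫⁻ ω in D, ENNReal.ofReal (B.weight (q ω) a) * (B.obs a).law C ∂P := by
      rw [Measure.restrict_apply' hθa, inter_right_comm, hlaw D C hD hC a, hpost D hD a,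
        lintegral_mul_const _ hweight]
    _ = ∫⁻ ω in D, (∫⁻ z, C.indicator 1 z * ENNReal.ofReal (B.weight (B.update (q ω) z) a) *
          ENNReal.ofReal (B.density (q ω) z)) ∂P := by
      refine lintegral_congr fun ω => ?_
      rw [ProbDensity.law, withDensity_apply _ hC,
        ← lintegral_const_mul _ (B.obs a).measurable.ennreal_ofReal, ← lintegral_indicator hC]
      refine lintegral_congr fun z => ?_
      rw [mul_assoc, ← ENNReal.ofReal_mul (update_mem_dom (hdom ω) z a),
        weight_update_mul_density (hdom ω), ENNReal.ofReal_mul (hdom ω a)]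
      by_cases hz : z ∈ C <;> simp [hz]
    _ = ∫⁻ ω in D, C.indicator 1 (x ω) *
          ENNReal.ofReal (B.weight (B.update (q ω) (x ω)) a) ∂P :=
      (setLIntegral_observation hm hθ hx hq hdom hpost hlaw hF hD).symm
    _ = P.withDensity (fun ω => ENNReal.ofReal (B.weight (B.update (q ω) (x ω)) a))
          (D ∩ x ⁻¹' C) := by
      rw [withDensity_apply _ ((hm D hD).inter (hx hC)), inter_comm,
        ← Measure.restrict_restrict (hx hC), ← lintegral_indicator (hx hC)]
      refine lintegral_congr fun ω => ?_
      by_cases hω : x ω ∈ C <;> simp [hω]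

end BayesFilter

theorem mem_of_hittingAfter_eq {Ω X : Type*} {u : ℕ → Ω → X} {s : Set X} {ω : Ω} {k : ℕ}
    (h : hittingAfter u s 0 ω = k) : u k ω ∈ s := by
  have hmem := hittingAfter_mem_set_of_ne_top (u := u) (s := s) (n := 0) (ω := ω)
    (h.trans_ne (WithTop.coe_ne_top (a := k)))
  rwa [h] at hmem

namespace BayesFilter

variable {Ω Θ X : Type*} [Fintype Θ] [MeasurableSpace X] {mΩ : MeasurableSpace Ω}

/-- The process `st` of states arises by making every observation in the state `q k`: given the
past `𝓕 k`, the next state `st (k + 1)` has the law of `B.update (q k) z` for an observation `z`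
with density `B.density (q k)`. -/
structure IsControlled (B : BayesFilter Θ X) (P : Measure Ω) (𝓕 : Filtration ℕ mΩ)
    (st q : ℕ → Ω → X) : Prop where
  mem_dom : ∀ k ω, st k ω ∈ B.dom
  control_mem_dom : ∀ k ω, q k ω ∈ B.dom
  setLIntegral_comp_succ : ∀ k (F : X → ℝ≥0∞), Measurable F → ∀ A, MeasurableSet[𝓕 k] A →
    ∫⁻ ω in A, F (st (k + 1) ω) ∂P =
      ∫⁻ ω in A, (∫⁻ z, F (B.update (q k ω) z) * ENNReal.ofReal (B.density (q k ω) z)) ∂P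

namespace IsControlled

variable {B : BayesFilter Θ X} {P : Measure Ω} {𝓕 : Filtration ℕ mΩ} {st q : ℕ → Ω → X}
  (h : B.IsControlled P 𝓕 st q)

include h

theorem setLIntegral_ofReal_succ {W : X → ℝ} (hW : Measurable W)
    (hW01 : ∀ x ∈ B.dom, W x ∈ Icc (0 : ℝ) 1) (k : ℕ) {A : Set Ω} (hA : MeasurableSet[𝓕 k] A) :
    ∫⁻ ω in A, ENNReal.ofReal (W (st (k + 1) ω)) ∂P =
      ∫⁻ ω in A, ENNReal.ofReal (B.expect W (q k ω)) ∂P := by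
  rw [h.setLIntegral_comp_succ k _ hW.ennreal_ofReal A hA]
  exact lintegral_congr fun ω => (ofReal_expect (h.control_mem_dom k ω) hW hW01).symm

variable (S : StoppingProblem B) {τ : Ω → WithTop ℕ} (hτ : IsStoppingTime 𝓕 τ)

include hτ

theorem obsCost_add_setLIntegral_succ (k : ℕ) :
    ENNReal.ofReal S.obsCost * P {ω | (k : WithTop ℕ) < τ ω} +
        ∫⁻ ω in {ω | (k : WithTop ℕ) < τ ω}, ENNReal.ofReal (S.value (st (k + 1) ω)) ∂P =
      ∫⁻ ω in {ω | (k : WithTop ℕ) < τ ω},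
        ENNReal.ofReal (S.obsCost + B.expect S.value (q k ω)) ∂P := by
  have hlt : MeasurableSet[𝓕 k] {ω | (k : WithTop ℕ) < τ ω} := hτ.measurableSet_gt k
  rw [h.setLIntegral_ofReal_succ S.measurable_value (fun _ hx => S.value_mem hx) k hlt,
    ← setLIntegral_const, ← lintegral_add_left measurable_const]
  exact lintegral_congr fun ω => (ENNReal.ofReal_add S.obsCost_pos.le
    (expect_nonneg (h.control_mem_dom k ω) fun x hx => (S.value_mem hx).1)).symm

theorem lintegral_value_le_stopped [IsFiniteMeasure P]
    (hq : ∀ k ω, q k ω = st k ω ∨ q k ω = S.reset (st k ω)) :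
    ∫⁻ ω, ENNReal.ofReal (S.value (st 0 ω)) ∂P ≤
      ENNReal.ofReal S.obsCost * ∫⁻ ω, ENat.toENNReal (τ ω) ∂P +
        ∫⁻ ω, ENNReal.ofReal (S.stopCost (st ((τ ω).untopD 0) ω)) ∂P := by
  refine (lintegral_le_stopped (u := fun k ω => ENNReal.ofReal (S.value (st k ω))) hτ.measurable'
    (ENNReal.ofReal_pos.2 S.obsCost_pos).ne'
    (fun k ω => ENNReal.ofReal_le_one.2 (S.value_mem (h.mem_dom k ω)).2) fun k => ?_).trans ?_
  · rw [h.obsCost_add_setLIntegral_succ S hτ]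
    refine lintegral_mono fun ω => ENNReal.ofReal_le_ofReal ?_
    refine (S.value_eq_min (h.mem_dom k ω)).trans_le
      ((min_le_right _ _).trans (add_le_add_right ?_ _))
    rcases hq k ω with hω | hω <;> rw [hω]
    exacts [min_le_left _ _, min_le_right _ _]
  · exact add_le_add_right (lintegral_mono fun ω =>
      ENNReal.ofReal_le_ofReal (S.value_le_stopCost (h.mem_dom _ ω))) _

theorem stopped_le_lintegral_value [IsProbabilityMeasure P]
    (hhit : ∀ᵐ ω ∂P, τ ω = hittingAfter st S.stopSet 0 ω)
    (hq : ∀ᵐ ω ∂P, ∀ k, B.expect S.value (q k ω) =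
      min (B.expect S.value (st k ω)) (B.expect S.value (S.reset (st k ω)))) :
    (∀ᵐ ω ∂P, τ ω ≠ ⊤) ∧ ENNReal.ofReal S.obsCost * ∫⁻ ω, ENat.toENNReal (τ ω) ∂P +
        ∫⁻ ω, ENNReal.ofReal (S.stopCost (st ((τ ω).untopD 0) ω)) ∂P ≤
      ∫⁻ ω, ENNReal.ofReal (S.value (st 0 ω)) ∂P := by
  obtain ⟨hfin, hle⟩ := stopped_le_lintegral (P := P) hτ.measurable'
    (u := fun k ω => ENNReal.ofReal (S.value (st k ω))) (ENNReal.ofReal_pos.2 S.obsCost_pos).ne'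
    (fun ω => ENNReal.ofReal_le_one.2 (S.value_mem (h.mem_dom 0 ω)).2) fun k => by
      rw [h.obsCost_add_setLIntegral_succ S hτ]
      refine setLIntegral_mono_ae' (𝓕.le k _ (hτ.measurableSet_gt k)) ?_
      filter_upwards [hhit, hq] with ω hω hqω (hk : (k : WithTop ℕ) < τ ω)
      have hnotMem := notMem_of_lt_hittingAfter (hk.trans_eq hω) (Nat.zero_le k)
      rw [hqω, S.value_eq_of_notMem_stopSet (h.mem_dom k ω) hnotMem]
  refine ⟨hfin, (add_le_add_right (lintegral_mono_ae ?_) _).trans hle⟩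
  filter_upwards [hfin, hhit] with ω htop hω
  obtain ⟨n, hn⟩ := WithTop.ne_top_iff_exists.1 htop
  have hmem : st n ω ∈ S.stopSet := mem_of_hittingAfter_eq (hω.symm.trans hn.symm)
  rw [← hn, WithTop.untopD_coe, hmem.2]

end IsControlled

end BayesFilter

section Filters

variable (f₀ f₁ : ProbDensity)

/-- The density of the samples of a sequence with hypothesis `H_1` (`true`) or `H_0` (`false`). -/
def hypDensity (a : Bool) : ProbDensity := if a then f₁ else f₀

/-- The probability of the hypothesis `H_1` (`true`) or `H_0` (`false`). -/
def priorWeight (π₀ : ℝ) (a : Bool) : ℝ := if a then π₀ else 1 - π₀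

/-- The probabilities of the hypotheses of the two sequences of a pair in the scanning state `p`.
By symmetry the probability `p^{mix}` is shared equally by the two mixed cases. -/
def scanWeight (p : ℝ × ℝ) : Bool × Bool → ℝ
  | (true, true) => p.1
  | (true, false) | (false, true) => p.2 / 2
  | (false, false) => 1 - p.1 - p.2

/-- The probabilities of the hypotheses of the two sequences of a pair in the refinement
state `r`. -/
def refineWeight (r : ℝ × ℝ × ℝ) : Bool × Bool → ℝ
  | (true, true) => r.1
  | (true, false) => r.2.1
  | (false, true) => r.2.2
  | (false, false) => 1 - r.1 - r.2.1 - r.2.2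

theorem forall_scanWeight_nonneg_iff {p : ℝ × ℝ} :
    (∀ a, 0 ≤ scanWeight p a) ↔ 0 ≤ p.1 ∧ 0 ≤ p.2 ∧ p.1 + p.2 ≤ 1 := by
  simp only [Prod.forall, Bool.forall_bool, scanWeight]
  constructor
  · rintro ⟨⟨h00, h01⟩, -, h11⟩
    exact ⟨h11, by linarith, by linarith⟩
  · rintro ⟨h11, hmix, hle⟩
    exact ⟨⟨by linarith, by linarith⟩, by linarith, h11⟩

theorem forall_refineWeight_nonneg_iff {r : ℝ × ℝ × ℝ} : (∀ a, 0 ≤ refineWeight r a) ↔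
    0 ≤ r.1 ∧ 0 ≤ r.2.1 ∧ 0 ≤ r.2.2 ∧ r.1 + r.2.1 + r.2.2 ≤ 1 := by
  simp only [Prod.forall, Bool.forall_bool, refineWeight]
  constructor
  · rintro ⟨⟨h00, h01⟩, h10, h11⟩
    exact ⟨h11, h10, h01, by linarith⟩
  · rintro ⟨h11, h10, h01, hle⟩
    exact ⟨⟨by linarith, h01⟩, h10, h11⟩

theorem sum_scanWeight_mul_conv (p : ℝ × ℝ) (z : ℝ) :
    ∑ a, scanWeight p a * (hypDensity f₀ f₁ a.1).conv (hypDensity f₀ f₁ a.2) z =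
      scanDensity f₀ f₁ p z := by
  simp only [Fintype.sum_prod_type, Fintype.sum_bool, scanWeight, hypDensity, Bool.false_eq_true,
    if_true, if_false, scanDensity, f₁.conv_comm f₀]
  ring

theorem sum_refineWeight_mul (r : ℝ × ℝ × ℝ) (x : ℝ) :
    ∑ a, refineWeight r a * (hypDensity f₀ f₁ a.1).f x = refineDensity f₀ f₁ r x := by
  simp only [Fintype.sum_prod_type, Fintype.sum_bool, refineWeight, hypDensity, Bool.false_eq_true,
    if_true, if_false, refineDensity]
  ring

theorem measurable_scanUpdate : Measurable (Function.uncurry (scanUpdate f₀ f₁)) := by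
  have h₀₀ := f₀.measurable_conv f₀
  have h₀₁ := f₀.measurable_conv f₁
  have h₁₁ := f₁.measurable_conv f₁
  unfold Function.uncurry scanUpdate scanDensity
  fun_prop

theorem measurable_refineUpdate : Measurable (Function.uncurry (refineUpdate f₀ f₁)) := by
  have h₀ := f₀.measurable
  have h₁ := f₁.measurable
  unfold Function.uncurry refineUpdate refineDensity
  fun_prop

theorem scanWeight_scanUpdate_nonneg {p : ℝ × ℝ} (hp : ∀ a, 0 ≤ scanWeight p a) (z : ℝ) :
    ∀ a, 0 ≤ scanWeight (scanUpdate f₀ f₁ p z) a := by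
  obtain ⟨h11, hmix, hle⟩ := forall_scanWeight_nonneg_iff.1 hp
  have h₀₀ : 0 ≤ (1 - p.1 - p.2) * f₀.conv f₀ z :=
    mul_nonneg (by linarith) (f₀.conv_nonneg f₀ z)
  have h₀₁ : 0 ≤ p.2 * f₀.conv f₁ z := mul_nonneg hmix (f₀.conv_nonneg f₁ z)
  have h₁₁ : 0 ≤ p.1 * f₁.conv f₁ z := mul_nonneg h11 (f₁.conv_nonneg f₁ z)
  have hdensity : 0 ≤ scanDensity f₀ f₁ p z := add_nonneg (add_nonneg h₀₀ h₀₁) h₁₁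
  refine forall_scanWeight_nonneg_iff.2
    ⟨div_nonneg h₁₁ hdensity, div_nonneg h₀₁ hdensity, ?_⟩
  rw [scanUpdate, ← add_div]
  refine div_le_one_of_le₀ ?_ hdensity
  rw [scanDensity]
  linarith

theorem refineWeight_refineUpdate_nonneg {r : ℝ × ℝ × ℝ} (hr : ∀ a, 0 ≤ refineWeight r a)
    (x : ℝ) : ∀ a, 0 ≤ refineWeight (refineUpdate f₀ f₁ r x) a := by
  obtain ⟨h11, h10, h01, hle⟩ := forall_refineWeight_nonneg_iff.1 hr
  have h₁₁ := mul_nonneg (f₁.nonneg x) h11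
  have h₁₀ := mul_nonneg (f₁.nonneg x) h10
  have h₀₁ := mul_nonneg (f₀.nonneg x) h01
  have hle' : f₁.f x * r.1 + f₁.f x * r.2.1 + f₀.f x * r.2.2 ≤ refineDensity f₀ f₁ r x := by
    rw [refineDensity]
    nlinarith [f₀.nonneg x]
  have hdensity : 0 ≤ refineDensity f₀ f₁ r x := by linarith
  refine forall_refineWeight_nonneg_iff.2 ⟨div_nonneg h₁₁ hdensity, div_nonneg h₁₀ hdensity,
    div_nonneg h₀₁ hdensity, ?_⟩
  rw [refineUpdate, ← add_div, ← add_div]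
  exact div_le_one_of_le₀ hle' hdensity

/-- The filter of the scanning stage: the parameter consists of the hypotheses of the two
sequences of the pair, the observation is the sum of their samples. -/
def scanFilter : BayesFilter (Bool × Bool) (ℝ × ℝ) where
  obs a := (hypDensity f₀ f₁ a.1).convolve (hypDensity f₀ f₁ a.2)
  weight := scanWeight
  update := scanUpdate f₀ f₁
  measurable_weight := by
    rintro ⟨_ | _, _ | _⟩ <;> simp only [scanWeight] <;> fun_prop
  measurable_update := measurable_scanUpdate f₀ f₁
  sum_weight p := by
    simp only [Fintype.sum_prod_type, Fintype.sum_bool, scanWeight]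
    ring
  weight_update_nonneg _ hp z := scanWeight_scanUpdate_nonneg f₀ f₁ hp z
  weight_update_mul_sum p z hne := by
    simp only [ProbDensity.convolve, sum_scanWeight_mul_conv f₀ f₁ p z] at hne ⊢
    rintro ⟨_ | _, _ | _⟩ <;>
      simp only [scanWeight, scanUpdate, hypDensity, if_true, Bool.false_eq_true, if_false,
        f₁.conv_comm f₀] <;>
      field_simp
    rw [scanDensity]
    ring

/-- The filter of the refinement stage: the parameter consists of the hypotheses of the two
sequences of the pair, the observation is a sample of the first one. -/
def refineFilter : BayesFilter (Bool × Bool) (ℝ × ℝ × ℝ) where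
  obs a := hypDensity f₀ f₁ a.1
  weight := refineWeight
  update := refineUpdate f₀ f₁
  measurable_weight := by
    rintro ⟨_ | _, _ | _⟩ <;> simp only [refineWeight] <;> fun_prop
  measurable_update := measurable_refineUpdate f₀ f₁
  sum_weight r := by
    simp only [Fintype.sum_prod_type, Fintype.sum_bool, refineWeight]
    ring
  weight_update_nonneg _ hr x := refineWeight_refineUpdate_nonneg f₀ f₁ hr x
  weight_update_mul_sum r x hne := by
    simp only [sum_refineWeight_mul f₀ f₁ r x] at hne ⊢
    rintro ⟨_ | _, _ | _⟩ <;>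
      simp only [refineWeight, refineUpdate, hypDensity, if_true, Bool.false_eq_true,
        if_false] <;>
      field_simp
    rw [refineDensity]
    ring

theorem scanFilter_dom : (scanFilter f₀ f₁).dom = scanDomain := by
  ext p
  refine forall_scanWeight_nonneg_iff.trans ⟨fun ⟨h11, hmix, hle⟩ => ?_, fun hp => ?_⟩
  · exact ⟨h11, by linarith, hmix, by linarith, by linarith, hle⟩
  · exact ⟨hp.1, hp.2.2.1, hp.2.2.2.2.2⟩

theorem scanFilter_expect : (scanFilter f₀ f₁).expect = scanExpect f₀ f₁ := by
  funext W p
  exact integral_congr_ae (ae_of_all _ fun z =>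
    congrArg (W (scanUpdate f₀ f₁ p z) * ·) (sum_scanWeight_mul_conv f₀ f₁ p z))

theorem refineFilter_expect (W : ℝ × ℝ × ℝ → ℝ) (r : ℝ × ℝ × ℝ) :
    (refineFilter f₀ f₁).expect W r =
      ∫ x, W (refineUpdate f₀ f₁ r x) * refineDensity f₀ f₁ r x :=
  integral_congr_ae (ae_of_all _ fun x =>
    congrArg (W (refineUpdate f₀ f₁ r x) * ·) (sum_refineWeight_mul f₀ f₁ r x))

/-- The refinement state in which the refinement stage starts, if the scanning stage ends in the
state `p`. -/
def refineStart (p : ℝ × ℝ) : ℝ × ℝ × ℝ := (p.1, p.2 / 2, p.2 / 2)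

theorem measurable_refineStart : Measurable refineStart := by
  unfold refineStart
  fun_prop

theorem refineWeight_refineStart (p : ℝ × ℝ) : refineWeight (refineStart p) = scanWeight p := by
  funext ⟨a, b⟩
  cases a <;> cases b <;> simp only [refineWeight, refineStart, scanWeight]
  ring

theorem refineStart_mem {p : ℝ × ℝ} (hp : p ∈ (scanFilter f₀ f₁).dom) :
    refineStart p ∈ (refineFilter f₀ f₁).dom := fun a =>
  (hp a).trans_eq (congrFun (refineWeight_refineStart p) a).symm

theorem scanWeight_scanPrior (π₀ : ℝ) (a : Bool × Bool) :
    scanWeight (scanPrior π₀) a = priorWeight π₀ a.1 * priorWeight π₀ a.2 := by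
  rcases a with ⟨_ | _, _ | _⟩ <;>
    simp only [scanWeight, scanPrior, priorWeight, if_true, Bool.false_eq_true, if_false] <;> ring

theorem priorWeight_nonneg {π₀ : ℝ} (hπ₀ : π₀ ∈ Icc (0 : ℝ) 1) (a : Bool) :
    0 ≤ priorWeight π₀ a := by
  cases a
  exacts [sub_nonneg.2 hπ₀.2, hπ₀.1]

theorem scanPrior_mem {π₀ : ℝ} (hπ₀ : π₀ ∈ Icc (0 : ℝ) 1) :
    scanPrior π₀ ∈ (scanFilter f₀ f₁).dom := fun a =>
  (mul_nonneg (priorWeight_nonneg hπ₀ a.1) (priorWeight_nonneg hπ₀ a.2)).trans_eq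
    (scanWeight_scanPrior π₀ a).symm

end Filters

section Problems

variable (f₀ f₁ : ProbDensity) {π₀ c : ℝ}

theorem refineStopCost_mem {r : ℝ × ℝ × ℝ} (hr : r ∈ (refineFilter f₀ f₁).dom) :
    refineStopCost r ∈ Icc (0 : ℝ) 1 := by
  obtain ⟨h11, h10, h01, hle⟩ := forall_refineWeight_nonneg_iff.1 hr
  exact ⟨sub_nonneg.2 (max_le (by linarith) (by linarith)),
    sub_le_self _ (le_max_of_le_left (by linarith))⟩

/-- The stopping problem of the refinement stage. The state is never reset. -/
def refineProblem (hc : 0 < c) : (refineFilter f₀ f₁).StoppingProblem where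
  stopCost := refineStopCost
  reset := id
  obsCost := c
  measurable_stopCost := by
    unfold refineStopCost
    fun_prop
  measurable_reset := measurable_id
  stopCost_mem _ hr := refineStopCost_mem f₀ f₁ hr
  reset_mem _ hr := hr
  obsCost_pos := hc

theorem refineProblem_value (hc : 0 < c) :
    (refineProblem f₀ f₁ hc).value = refineValue f₀ f₁ c := by
  have hvalueUpTo : ∀ n, (refineProblem f₀ f₁ hc).valueUpTo n = refineValueUpTo f₀ f₁ c n := by
    intro n
    induction n with
    | zero => rfl
    | succ n ih =>
      funext r
      exact congrArg (fun e => min (refineStopCost r) (c + e))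
        ((min_self _).trans (ih ▸ refineFilter_expect f₀ f₁ _ r))
  funext r
  exact iInf_congr fun n => congrFun (hvalueUpTo n) r

/-- The stopping problem of the scanning stage. Resetting the state is switching to a fresh
pair. -/
def scanProblem (hπ₀ : π₀ ∈ Icc (0 : ℝ) 1) (hc : 0 < c) :
    (scanFilter f₀ f₁).StoppingProblem where
  stopCost := scanStopCost f₀ f₁ c
  reset _ := scanPrior π₀
  obsCost := c
  measurable_stopCost := by
    have hvalue := (refineProblem f₀ f₁ hc).measurable_value
    rw [refineProblem_value] at hvalue
    exact hvalue.comp measurable_refineStart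
  measurable_reset := measurable_const
  stopCost_mem p hp := by
    have hvalue := (refineProblem f₀ f₁ hc).value_mem (refineStart_mem f₀ f₁ hp)
    rwa [refineProblem_value] at hvalue
  reset_mem _ _ := scanPrior_mem f₀ f₁ hπ₀
  obsCost_pos := hc

theorem scanProblem_value (hπ₀ : π₀ ∈ Icc (0 : ℝ) 1) (hc : 0 < c) :
    (scanProblem f₀ f₁ hπ₀ hc).value = scanValue f₀ f₁ π₀ c := by
  have hvalueUpTo : ∀ n,
      (scanProblem f₀ f₁ hπ₀ hc).valueUpTo n = scanValueUpTo f₀ f₁ π₀ c n := by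
    intro n
    induction n with
    | zero => rfl
    | succ n ih =>
      funext p
      rw [BayesFilter.StoppingProblem.valueUpTo, ih, scanFilter_expect]
      rfl
  funext p
  exact iInf_congr fun n => congrFun (hvalueUpTo n) p

theorem mem_stopSet_scanProblem (hπ₀ : π₀ ∈ Icc (0 : ℝ) 1) (hc : 0 < c) {p : ℝ × ℝ}
    (hp : p ∈ scanDomain) : p ∈ (scanProblem f₀ f₁ hπ₀ hc).stopSet ↔
      scanStopCost f₀ f₁ c p = scanValue f₀ f₁ π₀ c p := by
  rw [← scanProblem_value f₀ f₁ hπ₀ hc]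
  exact and_iff_right (scanFilter_dom f₀ f₁ ▸ hp)

theorem mem_switchSet_scanProblem (hπ₀ : π₀ ∈ Icc (0 : ℝ) 1) (hc : 0 < c) {p : ℝ × ℝ}
    (hp : p ∈ scanDomain) : p ∈ (scanProblem f₀ f₁ hπ₀ hc).switchSet ↔
      ¬ continueCost f₀ f₁ π₀ c p ≤ switchCost f₀ f₁ π₀ c := by
  rw [continueCost, switchCost, ← scanProblem_value f₀ f₁ hπ₀ hc, ← scanFilter_expect]
  exact and_iff_right (scanFilter_dom f₀ f₁ ▸ hp)

end Problems

theorem measurable_snoc {Ω : Type*} {m : MeasurableSpace Ω} {k : ℕ} {h : Ω → Fin k → ℝ} {x : Ω → ℝ}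
    (hh : Measurable h) (hx : Measurable x) :
    Measurable fun ω => (Fin.snoc (α := fun _ => ℝ) (h ω) (x ω) : Fin (k + 1) → ℝ) := by
  refine measurable_pi_iff.2 (Fin.lastCases ?_ fun j => ?_)
  · simpa only [Fin.snoc_last] using hx
  · simp only [Fin.snoc_castSucc]
    exact (measurable_pi_apply j).comp hh

theorem comap_prodMk_pi_le {Ω ι X E : Type*} [MeasurableSpace X] [MeasurableSpace E]
    {m : MeasurableSpace Ω} {h : Ω → X} {y : ι → Ω → E} (hh : Measurable h)
    (hy : ∀ i, Measurable (y i)) :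
    MeasurableSpace.comap (fun ω => (h ω, fun i => y i ω)) inferInstance ≤ m :=
  (hh.prodMk (measurable_pi_iff.2 hy)).comap_le

theorem infinitePi_restrict_inter_eval {ι : Type*} {X : ι → Type*} [∀ i, MeasurableSpace (X i)]
    (μ : ∀ i, Measure (X i)) [∀ i, IsProbabilityMeasure (μ i)] {s : Finset ι} {i : ι} (hi : i ∉ s)
    {A : Set (∀ j : s, X j)} (hA : MeasurableSet A) {C : Set (X i)} (hC : MeasurableSet C) :
    Measure.infinitePi μ (s.restrict ⁻¹' A ∩ Function.eval i ⁻¹' C) =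
      Measure.infinitePi μ (s.restrict ⁻¹' A) * μ i C := by
  have hindep : IndepFun s.restrict (Function.eval i) (Measure.infinitePi μ) :=
    ((iIndepFun_infinitePi (P := μ) (X := fun _ x => x) fun _ => measurable_id).indepFun_finset
      s {i} (Finset.disjoint_singleton_right.2 hi) fun j => measurable_pi_apply j).comp
        measurable_id (measurable_pi_apply (⟨i, Finset.mem_singleton_self i⟩ : ({i} : Finset ι)))
  rw [hindep.measure_inter_preimage_eq_mul _ _ hA hC,
    ← Measure.map_apply (measurable_pi_apply i) hC, Measure.infinitePi_map_eval]

namespace SwitchRule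

variable (φ : SwitchRule)

/-- `SearchModel.path` as a function of the samples `y s i`. -/
def pathOf (y : ℕ → ℕ → ℝ) : (k : ℕ) → ℕ × (Fin k → ℝ)
  | 0 => (0, Fin.elim0)
  | k + 1 =>
    let h := pathOf y k
    let n := if φ.rule k h.2 then h.1 + 1 else h.1
    (n, Fin.snoc (α := fun _ => ℝ) h.2 (y (2 * n) (k + 1) + y (2 * n + 1) (k + 1)))

theorem measurable_pathOf {Ω : Type*} [MeasurableSpace Ω] {y : ℕ → ℕ → Ω → ℝ} (k : ℕ)
    (hy : ∀ s, ∀ i ≤ k, Measurable (y s i)) :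
    Measurable fun ω => φ.pathOf (fun s i => y s i ω) k := by
  induction k with
  | zero => exact measurable_const
  | succ k ih =>
    have ih := ih fun s i hi => hy s i (hi.trans k.le_succ)
    have hpair : Measurable fun ω => if φ.rule k (φ.pathOf (fun s i => y s i ω) k).2 then
        (φ.pathOf (fun s i => y s i ω) k).1 + 1 else (φ.pathOf (fun s i => y s i ω) k).1 :=
      Measurable.ite (((φ.measurable k).comp ih.snd) (measurableSet_singleton true))
        (ih.fst.add_const 1) ih.fst
    have hsamples := fun s => hy s (k + 1) le_rfl
    exact hpair.prodMk (measurable_snoc ih.snd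
      ((measurable_apply_index (hpair.const_mul 2) hsamples).add
        (measurable_apply_index ((hpair.const_mul 2).add_const 1) hsamples)))

theorem pathOf_congr {y y' : ℕ → ℕ → ℝ} {n : ℕ} (h : ∀ s < 2 * n + 2, ∀ i, y s i = y' s i) (k : ℕ)
    (hk : (φ.pathOf y k).1 ≤ n) : φ.pathOf y k = φ.pathOf y' k := by
  induction k with
  | zero => rfl
  | succ k ih =>
    simp only [pathOf] at hk ⊢
    have hle : (φ.pathOf y k).1 ≤ n := by split_ifs at hk <;> omega
    rw [ih hle] at hk ⊢
    rw [h _ (by omega), h _ (by omega)]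

end SwitchRule

namespace SearchModel

variable {f₀ f₁ : ProbDensity} {π₀ : ℝ} {Ω : Type u} [mΩ : MeasurableSpace Ω] {P : Measure Ω}
  (M : SearchModel f₀ f₁ π₀ P) (φ : SwitchRule)

theorem path_eq_pathOf (k : ℕ) (ω : Ω) :
    M.path φ k ω = φ.pathOf (fun s i => M.Y s i ω) k := by
  induction k with
  | zero => rfl
  | succ k ih => simp only [path, SwitchRule.pathOf, ih]

/-- The hypothesis and the samples of a sequence. -/
def sequence (s : ℕ) (ω : Ω) : Bool × (ℕ → ℝ) := (M.H s ω, fun k => M.Y s k ω)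

theorem measurable_sequence (s : ℕ) : Measurable (M.sequence s) :=
  (M.measurable_H s).prodMk (measurable_pi_iff.2 (M.measurable_Y s))

/-- The information in the sequence `s`. -/
abbrev sequenceSpace (s : ℕ) : MeasurableSpace Ω :=
  MeasurableSpace.comap (M.sequence s) inferInstance

theorem sequenceSpace_le (s : ℕ) : M.sequenceSpace s ≤ mΩ := (M.measurable_sequence s).comap_le

theorem measurable_H_sequenceSpace (s : ℕ) : Measurable[M.sequenceSpace s] (M.H s) :=
  measurable_fst.comp (comap_measurable (M.sequence s))

theorem measurable_Y_sequenceSpace (s k : ℕ) : Measurable[M.sequenceSpace s] (M.Y s k) :=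
  (measurable_pi_apply k).comp (measurable_snd.comp (comap_measurable (M.sequence s)))

/-- The information in all sequences except `s`. -/
abbrev othersSpace (s : ℕ) : MeasurableSpace Ω := ⨆ i ∈ ({s}ᶜ : Set ℕ), M.sequenceSpace i

theorem sequenceSpace_le_othersSpace {s i : ℕ} (h : i ≠ s) :
    M.sequenceSpace i ≤ M.othersSpace s :=
  le_iSup₂_of_le i h le_rfl

theorem othersSpace_le (s : ℕ) : M.othersSpace s ≤ mΩ := iSup₂_le fun i _ => M.sequenceSpace_le i

theorem indep_sequenceSpace_othersSpace (s : ℕ) :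
    Indep (M.sequenceSpace s) (M.othersSpace s) P := by
  have h := indep_iSup_of_disjoint M.sequenceSpace_le M.indep (disjoint_compl_right (a := {s}))
  rwa [iSup_singleton] at h

/-- The information in the hypothesis of the sequence `s` and its samples up to time `k`. -/
abbrev pastSpace (s k : ℕ) : MeasurableSpace Ω :=
  MeasurableSpace.comap (fun ω => (M.H s ω, fun i : Finset.Iic k => M.Y s i ω)) inferInstance

theorem measurable_H_pastSpace (s k : ℕ) : Measurable[M.pastSpace s k] (M.H s) :=
  measurable_fst.comp (comap_measurable fun ω => (M.H s ω, fun i : Finset.Iic k => M.Y s i ω))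

theorem measurable_Y_pastSpace (s : ℕ) {i k : ℕ} (h : i ≤ k) :
    Measurable[M.pastSpace s k] (M.Y s i) :=
  (measurable_pi_apply (⟨i, Finset.mem_Iic.2 h⟩ : Finset.Iic k)).comp
    (measurable_snd.comp
      (comap_measurable fun ω => (M.H s ω, fun i : Finset.Iic k => M.Y s i ω)))

theorem pastSpace_le_sequenceSpace (s k : ℕ) : M.pastSpace s k ≤ M.sequenceSpace s :=
  comap_prodMk_pi_le (M.measurable_H_sequenceSpace s) fun i => M.measurable_Y_sequenceSpace s i

/-- The information in all hypotheses and in all samples up to time `k`, observed or not. -/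
def fullFiltration : Filtration ℕ mΩ where
  seq k := ⨆ s, M.pastSpace s k
  mono' _ j hij := iSup_mono fun s => comap_prodMk_pi_le (M.measurable_H_pastSpace s j)
    fun i => M.measurable_Y_pastSpace s ((Finset.mem_Iic.1 i.2).trans hij)
  le' k := iSup_le fun s => (M.pastSpace_le_sequenceSpace s k).trans (M.sequenceSpace_le s)

theorem measurable_H_full (s k : ℕ) : Measurable[M.fullFiltration k] (M.H s) :=
  (M.measurable_H_pastSpace s k).mono (le_iSup (fun s => M.pastSpace s k) s) le_rfl

theorem measurable_Y_full (s : ℕ) {i k : ℕ} (h : i ≤ k) :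
    Measurable[M.fullFiltration k] (M.Y s i) :=
  (M.measurable_Y_pastSpace s h).mono (le_iSup (fun s => M.pastSpace s k) s) le_rfl

theorem fullFiltration_le_pastSpace_sup_othersSpace (s k : ℕ) :
    M.fullFiltration k ≤ M.pastSpace s k ⊔ M.othersSpace s := by
  refine iSup_le fun i => ?_
  obtain rfl | hi := eq_or_ne i s
  · exact le_sup_left
  · exact le_sup_of_le_right
      ((M.pastSpace_le_sequenceSpace i k).trans (M.sequenceSpace_le_othersSpace hi))

theorem measurable_path_full (k : ℕ) : Measurable[M.fullFiltration k] (M.path φ k) := by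
  have h := @SwitchRule.measurable_pathOf φ Ω (M.fullFiltration k) M.Y k
    fun s i hi => M.measurable_Y_full s hi
  simpa only [← M.path_eq_pathOf φ] using h

theorem measurable_pair_full (k : ℕ) : Measurable[M.fullFiltration k] (M.pair φ k) :=
  measurable_fst.comp (M.measurable_path_full φ k)

theorem scanFiltration_le_full (k : ℕ) : M.scanFiltration φ k ≤ M.fullFiltration k :=
  (measurable_snd.comp (M.measurable_path_full φ k)).comap_le

theorem measure_sequence_preimage_inter {T : Set (Bool × (ℕ → ℝ))} (hT : MeasurableSet T) (s : ℕ)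
    (a : Bool) : P (M.sequence s ⁻¹' T ∩ M.H s ⁻¹' {a}) = ENNReal.ofReal (priorWeight π₀ a) *
      Measure.infinitePi (fun _ : ℕ => (hypDensity f₀ f₁ a).law) (Prod.mk a ⁻¹' T) := by
  have hTa : MeasurableSet (T ∩ Prod.fst ⁻¹' {a}) :=
    hT.inter (measurable_fst (measurableSet_singleton a))
  have hlaw := M.law s
  change P (M.sequence s ⁻¹' (T ∩ Prod.fst ⁻¹' {a})) = _
  change P.map (M.sequence s) = _ at hlaw
  rw [← Measure.map_apply (M.measurable_sequence s) hTa, hlaw]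
  simp only [Measure.dirac_prod, Measure.add_apply, Measure.smul_apply,
    Measure.map_apply measurable_prodMk_left hTa, smul_eq_mul]
  cases a <;> simp [priorWeight, hypDensity, preimage_preimage]

theorem hasCondLaw_pastSpace (s k : ℕ) : HasCondLaw (M.pastSpace s k) P (M.H s) (M.Y s (k + 1))
    fun a => (hypDensity f₀ f₁ a).law := by
  rintro _ C ⟨A, hA, rfl⟩ hC a
  set past : Set (Bool × (ℕ → ℝ)) := {z | (z.1, (Finset.Iic k).restrict z.2) ∈ A}
  set next : Set (Bool × (ℕ → ℝ)) := {z | z.2 (k + 1) ∈ C}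
  have hpast : MeasurableSet past :=
    (measurable_fst.prodMk ((Finset.measurable_restrict _).comp measurable_snd)) hA
  have hnext : MeasurableSet next := ((measurable_pi_apply (k + 1)).comp measurable_snd) hC
  change P (M.sequence s ⁻¹' past ∩ M.H s ⁻¹' {a} ∩ M.sequence s ⁻¹' next) =
    P (M.sequence s ⁻¹' past ∩ M.H s ⁻¹' {a}) * (hypDensity f₀ f₁ a).law C
  rw [inter_right_comm, ← preimage_inter,
    M.measure_sequence_preimage_inter (hpast.inter hnext) s a,
    M.measure_sequence_preimage_inter hpast s a, mul_assoc]
  exact congrArg (_ * ·) (infinitePi_restrict_inter_eval (i := k + 1) _ (by simp)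
    (measurable_prodMk_left hA) hC)

variable [IsProbabilityMeasure P]

theorem hasCondLaw_pastSpace_sup_othersSpace (s k : ℕ) :
    HasCondLaw (M.pastSpace s k ⊔ M.othersSpace s) P (M.H s) (M.Y s (k + 1))
      fun a => (hypDensity f₀ f₁ a).law :=
  (M.hasCondLaw_pastSpace s k).sup_of_indep (M.pastSpace_le_sequenceSpace s k)
    (M.measurable_H_sequenceSpace s) (M.measurable_Y_sequenceSpace s (k + 1))
    (M.indep_sequenceSpace_othersSpace s) (M.sequenceSpace_le s) (M.othersSpace_le s)

theorem hasCondLaw_full (s k : ℕ) : HasCondLaw (M.fullFiltration k) P (M.H s) (M.Y s (k + 1))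
    fun a => (hypDensity f₀ f₁ a).law :=
  (M.hasCondLaw_pastSpace_sup_othersSpace s k).mono
    (M.fullFiltration_le_pastSpace_sup_othersSpace s k)

theorem hasCondLaw_full_add {s t : ℕ} (hst : s ≠ t) (k : ℕ) :
    HasCondLaw (M.fullFiltration k) P (fun ω => (M.H s ω, M.H t ω))
      (fun ω => M.Y s (k + 1) ω + M.Y t (k + 1) ω)
      fun a => ((hypDensity f₀ f₁ a.1).convolve (hypDensity f₀ f₁ a.2)).law := by
  have hle : M.sequenceSpace s ≤ M.pastSpace t k ⊔ M.othersSpace t :=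
    (M.sequenceSpace_le_othersSpace hst).trans le_sup_right
  simp only [ProbDensity.law_convolve]
  exact (M.hasCondLaw_full s k).add (M.hasCondLaw_pastSpace_sup_othersSpace t k)
    (M.fullFiltration_le_pastSpace_sup_othersSpace t k)
    (sup_le ((M.pastSpace_le_sequenceSpace t k).trans (M.sequenceSpace_le t)) (M.othersSpace_le t))
    ((M.measurable_H_sequenceSpace s).mono hle le_rfl)
    ((M.measurable_Y_sequenceSpace s (k + 1)).mono hle le_rfl)
    (M.measurable_H_full t k) (M.measurable_Y t (k + 1))

/-- The information in the sequences before `s`. -/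
abbrev earlierSpace (s : ℕ) : MeasurableSpace Ω := ⨆ i ∈ Iio s, M.sequenceSpace i

omit [IsProbabilityMeasure P]

theorem sequenceSpace_le_earlierSpace {s i : ℕ} (h : i < s) :
    M.sequenceSpace i ≤ M.earlierSpace s := le_iSup₂_of_le i h le_rfl

theorem earlierSpace_le_othersSpace {s t : ℕ} (h : s ≤ t) :
    M.earlierSpace s ≤ M.othersSpace t :=
  iSup₂_le fun _ hi => M.sequenceSpace_le_othersSpace (hi.trans_le h).ne

theorem measure_H (s : ℕ) (a : Bool) :
    P (M.H s ⁻¹' {a}) = ENNReal.ofReal (priorWeight π₀ a) := by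
  simpa only [preimage_univ, univ_inter, measure_univ, mul_one] using
    M.measure_sequence_preimage_inter MeasurableSet.univ s a

theorem measure_inter_H {s : ℕ} {A : Set Ω} (hA : MeasurableSet[M.othersSpace s] A) (a : Bool) :
    P (A ∩ M.H s ⁻¹' {a}) = P A * ENNReal.ofReal (priorWeight π₀ a) := by
  rw [inter_comm, (Indep_iff _ _ _).1 (M.indep_sequenceSpace_othersSpace s) _ _
    (M.measurable_H_sequenceSpace s (measurableSet_singleton a)) hA, M.measure_H, mul_comm]

/-- The hypotheses of the two sequences of the pair `n`. -/
def pairStatus (n : ℕ) (ω : Ω) : Bool × Bool := (M.H (2 * n) ω, M.H (2 * n + 1) ω)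

theorem measurable_pairStatus (n : ℕ) : Measurable (M.pairStatus n) :=
  (M.measurable_H _).prodMk (M.measurable_H _)

theorem isPosterior_pairStatus (hπ₀ : π₀ ∈ Icc (0 : ℝ) 1) (n : ℕ) :
    IsPosterior (M.earlierSpace (2 * n)) P (M.pairStatus n)
      fun _ => scanWeight (scanPrior π₀) := by
  rintro A hA ⟨a, b⟩
  have hset : A ∩ M.pairStatus n ⁻¹' {(a, b)} =
      A ∩ M.H (2 * n) ⁻¹' {a} ∩ M.H (2 * n + 1) ⁻¹' {b} := by
    ext ω
    simp only [pairStatus, mem_inter_iff, mem_preimage, mem_singleton_iff, Prod.mk.injEq,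
      and_assoc]
  have hAH : MeasurableSet[M.othersSpace (2 * n + 1)] (A ∩ M.H (2 * n) ⁻¹' {a}) :=
    MeasurableSet.inter (M.earlierSpace_le_othersSpace (Nat.le_succ _) A hA)
      (M.sequenceSpace_le_othersSpace (Nat.lt_succ_self _).ne _
        (M.measurable_H_sequenceSpace _ (measurableSet_singleton a)))
  rw [hset, M.measure_inter_H hAH, M.measure_inter_H (M.earlierSpace_le_othersSpace le_rfl A hA),
    setLIntegral_const, scanWeight_scanPrior, ENNReal.ofReal_mul (priorWeight_nonneg hπ₀ a)]
  ring

theorem measurableSet_inter_pair {k : ℕ} {A : Set Ω} (hA : MeasurableSet[M.scanFiltration φ k] A)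
    (n : ℕ) : MeasurableSet[M.earlierSpace (2 * (n + 1))] (A ∩ M.pair φ k ⁻¹' {n}) := by
  obtain ⟨A, hA, rfl⟩ := hA
  let y : ℕ → ℕ → Ω → ℝ := fun s i => if s < 2 * n + 2 then M.Y s i else 0
  have hy : ∀ s i, Measurable[M.earlierSpace (2 * (n + 1))] (y s i) := fun s i => by
    by_cases hs : s < 2 * n + 2
    · simp only [y, hs, if_true]
      exact (M.measurable_Y_sequenceSpace s i).mono (M.sequenceSpace_le_earlierSpace hs) le_rfl
    · simp only [y, hs, if_false]
      exact measurable_const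
  have hset : M.hist φ k ⁻¹' A ∩ M.pair φ k ⁻¹' {n} =
      (fun ω => φ.pathOf (fun s i => y s i ω) k) ⁻¹' ({n} ×ˢ A) := by
    ext ω
    have hYy : ∀ s < 2 * n + 2, ∀ i, M.Y s i ω = y s i ω := fun s hs i => by
      simp only [y, hs, if_true]
    simp only [mem_inter_iff, mem_preimage, mem_singleton_iff, mem_prod, hist, pair,
      M.path_eq_pathOf]
    constructor
    · rintro ⟨hA, hn⟩
      rw [← φ.pathOf_congr hYy k hn.le]
      exact ⟨hn, hA⟩
    · rintro ⟨hn, hA⟩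
      rw [← φ.pathOf_congr (fun s hs i => (hYy s hs i).symm) k hn.le]
      exact ⟨hA, hn⟩
  rw [hset]
  exact (@SwitchRule.measurable_pathOf φ Ω (M.earlierSpace (2 * (n + 1))) y k
    fun s i _ => hy s i) ((measurableSet_singleton n).prod hA)

end SearchModel

theorem IsPosterior.condExp_indicator_ae_eq {Ω Θ : Type*} {m mΩ : MeasurableSpace Ω}
    {P : Measure Ω} [IsFiniteMeasure P] [Countable Θ] [MeasurableSpace Θ]
    [MeasurableSingletonClass Θ] {θ : Ω → Θ} {w : Ω → Θ → ℝ} (h : IsPosterior m P θ w) (hm : m ≤ mΩ)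
    (hθ : Measurable θ) (hw : ∀ a, Measurable[m] fun ω => w ω a) (hw0 : ∀ ω a, 0 ≤ w ω a)
    (D : Finset Θ) : P[(θ ⁻¹' D).indicator (fun _ => (1 : ℝ)) | m] =ᵐ[P]
      fun ω => ∑ a ∈ D, w ω a := by
  have hθD : MeasurableSet (θ ⁻¹' D) := hθ D.measurableSet
  have hsum : Measurable[m] fun ω => ∑ a ∈ D, w ω a :=
    @Finset.measurable_fun_sum _ _ _ _ _ _ m _ D fun a _ => hw a
  have hsum0 : ∀ ω, 0 ≤ ∑ a ∈ D, w ω a := fun ω => Finset.sum_nonneg fun a _ => hw0 ω a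
  have hset : ∀ A, MeasurableSet[m] A →
      ∫⁻ ω in A, ENNReal.ofReal (∑ a ∈ D, w ω a) ∂P = P (A ∩ θ ⁻¹' D) := fun A hA => by
    simp only [ENNReal.ofReal_sum_of_nonneg fun a _ => hw0 _ a]
    exact (h.measure_inter_mem hm hθ hw (D := fun _ => D) (fun a => MeasurableSet.const _) hA).symm
  have hint : Integrable (fun ω => ∑ a ∈ D, w ω a) P := by
    refine ⟨(hsum.mono hm le_rfl).aestronglyMeasurable, ?_⟩
    rw [hasFiniteIntegral_iff_ofReal (ae_of_all _ hsum0), ← setLIntegral_univ,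
      hset _ MeasurableSet.univ]
    exact measure_lt_top P _
  refine (ae_eq_condExp_of_forall_setIntegral_eq hm ((integrable_const 1).indicator hθD)
    (fun A _ _ => hint.integrableOn) (fun A hA _ => ?_)
    hsum.stronglyMeasurable.aestronglyMeasurable).symm
  rw [integral_eq_lintegral_of_nonneg_ae (ae_of_all _ hsum0)
    (hsum.mono hm le_rfl).aestronglyMeasurable, hset A hA, setIntegral_indicator hθD,
    setIntegral_const, smul_eq_mul, mul_one, Measure.real]

namespace SearchModel

variable {f₀ f₁ : ProbDensity} {π₀ : ℝ} {Ω : Type u} [mΩ : MeasurableSpace Ω] {P : Measure Ω}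
  (M : SearchModel f₀ f₁ π₀ P) (φ : SwitchRule)

/-- The mixed observation `Z_k` (for `1 ≤ k`). -/
def mixedObs (k : ℕ) (ω : Ω) : ℝ :=
  M.Y (2 * M.pair φ k ω) k ω + M.Y (2 * M.pair φ k ω + 1) k ω

/-- The hypotheses of the pair under observation at time `k`. -/
def status (k : ℕ) (ω : Ω) : Bool × Bool := M.pairStatus (M.pair φ k ω) ω

theorem hist_succ (k : ℕ) (ω : Ω) : M.hist φ (k + 1) ω =
    Fin.snoc (α := fun _ => ℝ) (M.hist φ k ω) (M.mixedObs φ (k + 1) ω) := rfl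

theorem pair_succ (k : ℕ) (ω : Ω) : M.pair φ (k + 1) ω =
    if φ.rule k (M.hist φ k ω) then M.pair φ k ω + 1 else M.pair φ k ω := rfl

theorem measurable_hist (k : ℕ) : Measurable[M.scanFiltration φ k] (M.hist φ k) :=
  comap_measurable _

theorem measurable_rule (k : ℕ) :
    Measurable[M.scanFiltration φ k] fun ω => φ.rule k (M.hist φ k ω) :=
  (φ.measurable k).comp (M.measurable_hist φ k)

theorem measurable_pair (k : ℕ) : Measurable (M.pair φ k) := (M.measurable_path φ k).fst

theorem measurable_pair_succ_full (k : ℕ) :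
    Measurable[M.fullFiltration k] (M.pair φ (k + 1)) :=
  Measurable.ite
    (M.scanFiltration_le_full φ k _ (M.measurable_rule φ k (measurableSet_singleton true)))
    ((M.measurable_pair_full φ k).add_const 1) (M.measurable_pair_full φ k)

theorem measurable_status (k : ℕ) : Measurable (M.status φ k) :=
  measurable_apply_index (M.measurable_pair φ k) M.measurable_pairStatus

theorem measurable_mixedObs (k : ℕ) : Measurable[M.scanFiltration φ (k + 1)]
    (M.mixedObs φ (k + 1)) := by
  have hlast := (measurable_pi_apply (Fin.last k)).comp (M.measurable_hist φ (k + 1))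
  simpa only [Function.comp_def, hist_succ, Fin.snoc_last] using hlast

theorem scanFiltration_succ_le (k : ℕ) : M.scanFiltration φ (k + 1) ≤
    M.scanFiltration φ k ⊔ MeasurableSpace.comap (M.mixedObs φ (k + 1)) inferInstance :=
  Measurable.comap_le (measurable_snoc ((M.measurable_hist φ k).mono le_sup_left le_rfl)
    ((comap_measurable (M.mixedObs φ (k + 1))).mono le_sup_right le_rfl))

/-- The scanning statistics at time `k`, computed recursively from the observations; they are a
version of `posterior`. -/
def stat : ℕ → Ω → ℝ × ℝ
  | 0, _ => scanPrior π₀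
  | k + 1, ω => scanUpdate f₀ f₁
      (if φ.rule k (M.hist φ k ω) then scanPrior π₀ else stat k ω) (M.mixedObs φ (k + 1) ω)

/-- The scanning statistics at time `k` of the pair that is observed at time `k + 1`. -/
def nextStat (k : ℕ) (ω : Ω) : ℝ × ℝ :=
  if φ.rule k (M.hist φ k ω) then scanPrior π₀ else M.stat φ k ω

theorem stat_succ (k : ℕ) (ω : Ω) : M.stat φ (k + 1) ω =
    scanUpdate f₀ f₁ (M.nextStat φ k ω) (M.mixedObs φ (k + 1) ω) := rfl

theorem measurable_nextStat_of_measurable_stat {k : ℕ}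
    (h : Measurable[M.scanFiltration φ k] (M.stat φ k)) :
    Measurable[M.scanFiltration φ k] (M.nextStat φ k) :=
  Measurable.ite (M.measurable_rule φ k (measurableSet_singleton true)) measurable_const h

theorem measurable_stat (k : ℕ) : Measurable[M.scanFiltration φ k] (M.stat φ k) := by
  induction k with
  | zero => exact measurable_const
  | succ k ih =>
    exact (measurable_scanUpdate f₀ f₁).comp
      (((M.measurable_nextStat_of_measurable_stat φ ih).mono
        ((M.scanFiltration φ).mono k.le_succ) le_rfl).prodMk (M.measurable_mixedObs φ k))

theorem measurable_nextStat (k : ℕ) : Measurable[M.scanFiltration φ k] (M.nextStat φ k) :=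
  M.measurable_nextStat_of_measurable_stat φ (M.measurable_stat φ k)

variable (hπ₀ : π₀ ∈ Icc (0 : ℝ) 1)

include hπ₀

theorem stat_mem (k : ℕ) (ω : Ω) : M.stat φ k ω ∈ (scanFilter f₀ f₁).dom := by
  induction k with
  | zero => exact scanPrior_mem f₀ f₁ hπ₀
  | succ k ih =>
    refine BayesFilter.update_mem_dom ?_ _
    split_ifs
    exacts [scanPrior_mem f₀ f₁ hπ₀, ih]

theorem nextStat_mem (k : ℕ) (ω : Ω) : M.nextStat φ k ω ∈ (scanFilter f₀ f₁).dom := by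
  unfold nextStat
  split_ifs
  exacts [scanPrior_mem f₀ f₁ hπ₀, M.stat_mem φ hπ₀ k ω]

theorem isPosterior_freshPair (k : ℕ) : IsPosterior (M.scanFiltration φ k) P
    (fun ω => M.pairStatus (M.pair φ k ω + 1) ω) fun _ => scanWeight (scanPrior π₀) :=
  .of_partition (IsAEPartition.fiber (M.measurable_pair φ k)) ((M.scanFiltration φ).le k)
    (fun n _ hA => M.measurableSet_inter_pair φ hA n)
    (measurable_apply_index ((M.measurable_pair φ k).add_const 1) M.measurable_pairStatus)
    (fun n ω (hω : M.pair φ k ω = n) => by rw [hω]) (fun _ _ _ => rfl)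
    fun n => M.isPosterior_pairStatus hπ₀ (n + 1)

theorem isPosterior_nextStat {k : ℕ} (h : IsPosterior (M.scanFiltration φ k) P (M.status φ k)
    fun ω => scanWeight (M.stat φ k ω)) : IsPosterior (M.scanFiltration φ k) P
      (M.status φ (k + 1)) fun ω => scanWeight (M.nextStat φ k ω) := by
  have hrule := (M.measurable_rule φ k).mono ((M.scanFiltration φ).le k) le_rfl
  refine .of_partition (IsAEPartition.fiber hrule) ((M.scanFiltration φ).le k)
    (m' := fun _ => M.scanFiltration φ k)
    (θ' := fun b => if b then fun ω => M.pairStatus (M.pair φ k ω + 1) ω else M.status φ k)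
    (w' := fun b ω => scanWeight (if b then scanPrior π₀ else M.stat φ k ω))
    (fun b A hA => MeasurableSet.inter hA (M.measurable_rule φ k (measurableSet_singleton b)))
    (M.measurable_status φ (k + 1)) ?_ (fun b ω (hω : _ = b) => by simp only [nextStat, hω]) ?_
  · rintro (_ | _) ω (hω : _ = _) <;> simp [status, pair_succ, hω]
  · rintro (_ | _)
    exacts [h, M.isPosterior_freshPair φ hπ₀ k]

omit hπ₀

variable [IsProbabilityMeasure P]

theorem hasCondLaw_mixedObs (k : ℕ) : HasCondLaw (M.scanFiltration φ k) P (M.status φ (k + 1))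
    (M.mixedObs φ (k + 1)) fun a => ((scanFilter f₀ f₁).obs a).law :=
  (HasCondLaw.comp_index (M.fullFiltration.le k) (M.measurable_pair_succ_full φ k)
    M.measurable_pairStatus (fun _ => (M.measurable_Y _ _).add (M.measurable_Y _ _))
    fun n => M.hasCondLaw_full_add (Nat.lt_succ_self (2 * n)).ne k).mono
      (M.scanFiltration_le_full φ k)

include hπ₀

theorem isPosterior_stat (k : ℕ) : IsPosterior (M.scanFiltration φ k) P (M.status φ k)
    fun ω => scanWeight (M.stat φ k ω) := by
  induction k with
  | zero =>
    have hle : M.scanFiltration φ 0 ≤ M.earlierSpace 0 :=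
      (measurable_const (a := (Fin.elim0 : Fin 0 → ℝ))).comap_le
    exact fun A hA => M.isPosterior_pairStatus hπ₀ 0 A (hle A hA)
  | succ k ih =>
    exact fun A hA => BayesFilter.isPosterior_update ((M.scanFiltration φ).le k)
      (M.measurable_status φ (k + 1))
      ((M.measurable_mixedObs φ k).mono ((M.scanFiltration φ).le _) le_rfl)
      (M.measurable_nextStat φ k) (M.nextStat_mem φ hπ₀ k) (M.isPosterior_nextStat φ hπ₀ ih)
      (M.hasCondLaw_mixedObs φ k) A (M.scanFiltration_succ_le φ k A hA)

theorem isControlled_stat : (scanFilter f₀ f₁).IsControlled P (M.scanFiltration φ) (M.stat φ)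
    (M.nextStat φ) where
  mem_dom := M.stat_mem φ hπ₀
  control_mem_dom := M.nextStat_mem φ hπ₀
  setLIntegral_comp_succ k _ hF _ hA :=
    BayesFilter.setLIntegral_observation ((M.scanFiltration φ).le k)
      (M.measurable_status φ (k + 1))
      ((M.measurable_mixedObs φ k).mono ((M.scanFiltration φ).le _) le_rfl)
      (M.measurable_nextStat φ k) (M.nextStat_mem φ hπ₀ k)
      (M.isPosterior_nextStat φ hπ₀ (M.isPosterior_stat φ hπ₀ k)) (M.hasCondLaw_mixedObs φ k)
      (hF.comp (measurable_scanUpdate f₀ f₁)) hA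

theorem posterior_ae_eq : ∀ᵐ ω ∂P, ∀ k, M.posterior φ k ω = M.stat φ k ω := by
  refine ae_all_iff.2 fun k => ?_
  have hcondExp := (M.isPosterior_stat φ hπ₀ k).condExp_indicator_ae_eq ((M.scanFiltration φ).le k)
    (M.measurable_status φ k)
    (fun a => ((scanFilter f₀ f₁).measurable_weight a).comp (M.measurable_stat φ k))
    (M.stat_mem φ hπ₀ k)
  have hboth : {ω | M.H (2 * M.pair φ k ω) ω = true ∧ M.H (2 * M.pair φ k ω + 1) ω = true} =
      M.status φ k ⁻¹' ({(true, true)} : Finset (Bool × Bool)) := by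
    ext ω
    simp [status, pairStatus]
  have hone : {ω | M.H (2 * M.pair φ k ω) ω ≠ M.H (2 * M.pair φ k ω + 1) ω} =
      M.status φ k ⁻¹' ({(true, false), (false, true)} : Finset (Bool × Bool)) := by
    ext ω
    cases h : M.H (2 * M.pair φ k ω) ω <;> simp [status, pairStatus, h]
  filter_upwards [hcondExp {(true, true)}, hcondExp {(true, false), (false, true)}]
    with ω hω hω'
  rw [posterior, hboth, hone, hω, hω', Finset.sum_singleton, Finset.sum_pair (by decide)]
  simp only [scanWeight, add_halves]

end SearchModel

section FeedbackRule

variable (f₀ f₁ : ProbDensity) (π₀ : ℝ) {R : Set (ℝ × ℝ)}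

open Classical in
/-- The scanning statistics as a function of the observations, when the observer switches exactly
in the states in `R`. -/
def feedbackStat (R : Set (ℝ × ℝ)) : (k : ℕ) → (Fin k → ℝ) → ℝ × ℝ
  | 0, _ => scanPrior π₀
  | k + 1, z => scanUpdate f₀ f₁
      (if feedbackStat R k (Fin.init z) ∈ R then scanPrior π₀ else feedbackStat R k (Fin.init z))
      (z (Fin.last k))

theorem measurable_feedbackStat (hR : MeasurableSet R) (k : ℕ) :
    Measurable (feedbackStat f₀ f₁ π₀ R k) := by
  induction k with
  | zero => exact measurable_const
  | succ k ih =>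
    have hprev : Measurable fun z : Fin (k + 1) → ℝ => feedbackStat f₀ f₁ π₀ R k (Fin.init z) :=
      ih.comp (measurable_pi_iff.2 fun i => measurable_pi_apply i.castSucc)
    exact (measurable_scanUpdate f₀ f₁).comp
      ((Measurable.ite (hprev hR) measurable_const hprev).prodMk
        (measurable_pi_apply (Fin.last k)))

open Classical in
/-- The rule that switches exactly in the states in `R`. -/
def feedbackRule (hR : MeasurableSet R) : SwitchRule where
  rule k z := decide (feedbackStat f₀ f₁ π₀ R k z ∈ R)
  measurable k := by
    refine measurable_to_bool ?_
    simpa only [preimage, mem_singleton_iff, decide_eq_true_eq] using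
      measurable_feedbackStat f₀ f₁ π₀ hR k hR

variable {f₀ f₁ π₀} {Ω : Type u} [MeasurableSpace Ω] {P : Measure Ω} (M : SearchModel f₀ f₁ π₀ P)

theorem feedbackRule_rule_eq_true_iff (hR : MeasurableSet R) {k : ℕ} {z : Fin k → ℝ} :
    (feedbackRule f₀ f₁ π₀ hR).rule k z = true ↔ feedbackStat f₀ f₁ π₀ R k z ∈ R := by
  simp only [feedbackRule, decide_eq_true_eq]

theorem stat_feedbackRule (hR : MeasurableSet R) (k : ℕ) (ω : Ω) :
    M.stat (feedbackRule f₀ f₁ π₀ hR) k ω =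
      feedbackStat f₀ f₁ π₀ R k (M.hist (feedbackRule f₀ f₁ π₀ hR) k ω) := by
  induction k with
  | zero => rfl
  | succ k ih =>
    rw [M.stat_succ, M.hist_succ, feedbackStat, Fin.init_snoc, Fin.snoc_last,
      SearchModel.nextStat, ih]
    congr 2
    simp only [feedbackRule_rule_eq_true_iff hR]

theorem switchesExactlyOn_feedbackRule [IsProbabilityMeasure P] (hπ₀ : π₀ ∈ Icc (0 : ℝ) 1)
    (hR : MeasurableSet R) : M.SwitchesExactlyOn (feedbackRule f₀ f₁ π₀ hR) R := by
  filter_upwards [M.posterior_ae_eq (feedbackRule f₀ f₁ π₀ hR) hπ₀] with ω hω k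
  rw [hω k, stat_feedbackRule M hR]
  exact feedbackRule_rule_eq_true_iff hR

end FeedbackRule

/-- The posterior probability that the claimed sequence, the first (`true`) or the second (`false`)
one of the pair, is generated by `f₁`. -/
def claimProb (b : Bool) (r : ℝ × ℝ × ℝ) : ℝ := r.1 + if b then r.2.1 else r.2.2

theorem refineStopCost_le_one_sub_claimProb (b : Bool) (r : ℝ × ℝ × ℝ) :
    refineStopCost r ≤ 1 - claimProb b r := by
  cases b
  exacts [sub_le_sub_left (le_max_right _ _) 1, sub_le_sub_left (le_max_left _ _) 1]

theorem refineStopCost_eq_one_sub_claimProb (r : ℝ × ℝ × ℝ) :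
    refineStopCost r = 1 - claimProb (decide (r.2.2 ≤ r.2.1)) r := by
  obtain h | h := le_or_gt r.2.2 r.2.1
  · simp only [refineStopCost, claimProb, h, decide_true, if_true, add_le_add_iff_left,
      max_eq_left]
  · simp only [refineStopCost, claimProb, h.not_ge, decide_false, Bool.false_eq_true, if_false,
      add_le_add_iff_left, h.le, max_eq_right]

/-- The statuses of a pair for which claiming the first (`true`) or the second (`false`) sequence
is an error. -/
def errorStatus (b : Bool) : Finset (Bool × Bool) := {(!b, b), (false, false)}

theorem sum_refineWeight_errorStatus (b : Bool) (r : ℝ × ℝ × ℝ) :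
    ∑ a ∈ errorStatus b, refineWeight r a = 1 - claimProb b r := by
  cases b <;> simp [errorStatus, refineWeight, claimProb] <;> ring

namespace SearchModel

variable {f₀ f₁ : ProbDensity} {π₀ : ℝ} {Ω : Type u} [mΩ : MeasurableSpace Ω] {P : Measure Ω}
  (M : SearchModel f₀ f₁ π₀ P) (φ : SwitchRule) {τ₀ : Ω → WithTop ℕ}

/-- The hypotheses of the pair under observation at the end of the scanning stage. -/
def stoppedStatus (τ₀ : Ω → WithTop ℕ) (ω : Ω) : Bool × Bool := M.status φ ((τ₀ ω).untopD 0) ω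

/-- The refinement statistics after `j` refinement samples, computed recursively; they determine
the conditional probabilities of the possible values of `stoppedStatus`. -/
def refineStat (τ₀ : Ω → WithTop ℕ) : ℕ → Ω → ℝ × ℝ × ℝ
  | 0, ω => refineStart (M.stat φ ((τ₀ ω).untopD 0) ω)
  | j + 1, ω => refineUpdate f₀ f₁ (refineStat τ₀ j ω) (M.refineSample φ τ₀ (j + 1) ω)

theorem refineStat_mem (hπ₀ : π₀ ∈ Icc (0 : ℝ) 1) (j : ℕ) (ω : Ω) :
    M.refineStat φ τ₀ j ω ∈ (refineFilter f₀ f₁).dom := by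
  induction j with
  | zero => exact refineStart_mem f₀ f₁ (M.stat_mem φ hπ₀ _ ω)
  | succ j ih => exact BayesFilter.update_mem_dom ih _

variable (hτ₀ : IsStoppingTime (M.scanFiltration φ) τ₀)

include hτ₀ in
theorem measurable_stoppedStatus : Measurable (M.stoppedStatus φ τ₀) :=
  measurable_apply_index (M.measurable_untopD φ hτ₀) (M.measurable_status φ)

theorem measurable_refineSample_refineFiltration {i j : ℕ} (hi : i ∈ Icc 1 j) :
    Measurable[M.refineFiltration φ hτ₀ j] (M.refineSample φ τ₀ i) :=
  (comap_measurable _).mono (le_sup_of_le_right (le_iSup₂_of_le i hi le_rfl)) le_rfl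

theorem refineFiltration_zero_le : M.refineFiltration φ hτ₀ 0 ≤ hτ₀.measurableSpace :=
  sup_le le_rfl (iSup₂_le fun _ hi => absurd (hi.1.trans hi.2) (Nat.not_succ_le_zero 0))

theorem refineFiltration_succ_le (j : ℕ) : M.refineFiltration φ hτ₀ (j + 1) ≤
    M.refineFiltration φ hτ₀ j ⊔
      MeasurableSpace.comap (M.refineSample φ τ₀ (j + 1)) inferInstance := by
  refine sup_le (le_sup_of_le_left le_sup_left) (iSup₂_le fun i hi => ?_)
  obtain h | rfl := hi.2.lt_or_eq
  · exact le_sup_of_le_left (M.measurable_refineSample_refineFiltration φ hτ₀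
      ⟨hi.1, Nat.lt_succ_iff.1 h⟩).comap_le
  · exact le_sup_right

theorem measurable_refineStat (j : ℕ) :
    Measurable[M.refineFiltration φ hτ₀ j] (M.refineStat φ τ₀ j) := by
  induction j with
  | zero =>
    exact (measurable_refineStart.comp (measurable_stopped hτ₀ (M.measurable_stat φ))).mono
      le_sup_left le_rfl
  | succ j ih =>
    exact (measurable_refineUpdate f₀ f₁).comp
      ((ih.mono ((M.refineFiltration φ hτ₀).mono j.le_succ) le_rfl).prodMk
        (M.measurable_refineSample_refineFiltration φ hτ₀ ⟨Nat.le_add_left 1 j, le_rfl⟩))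

/-- `fullFiltration` with the time shifted by `j`. -/
def shiftedFiltration (j : ℕ) : Filtration ℕ mΩ where
  seq t := M.fullFiltration (t + j)
  mono' _ _ h := M.fullFiltration.mono (Nat.add_le_add_right h j)
  le' t := M.fullFiltration.le (t + j)

theorem scanFiltration_le_shifted (j t : ℕ) : M.scanFiltration φ t ≤ M.shiftedFiltration j t :=
  (M.scanFiltration_le_full φ t).trans (M.fullFiltration.mono (Nat.le_add_right t j))

include hτ₀ in
theorem isStoppingTime_shifted (j : ℕ) : IsStoppingTime (M.shiftedFiltration j) τ₀ :=
  fun t => M.scanFiltration_le_shifted φ j t _ (hτ₀ t)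

theorem refineFiltration_le_shifted (j : ℕ) : M.refineFiltration φ hτ₀ j ≤
    (M.isStoppingTime_shifted φ hτ₀ j).measurableSpace := by
  refine sup_le (fun A hA => ⟨iSup_mono (M.scanFiltration_le_shifted φ j) A hA.1, fun t =>
    M.scanFiltration_le_shifted φ j t _ (hA.2 t)⟩) (iSup₂_le fun i hi => Measurable.comap_le ?_)
  refine measurable_stopped _ (u := fun t ω => M.Y (2 * M.pair φ t ω) (t + i) ω) fun t => ?_
  exact @measurable_apply_index Ω ℕ ℝ (M.shiftedFiltration j t) _ _ _ _ _
    (((M.measurable_pair_full φ t).mono (M.fullFiltration.mono (Nat.le_add_right t j))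
      le_rfl).const_mul 2) _ fun s => M.measurable_Y_full s (Nat.add_le_add_left hi.2 t)

theorem measurableSet_inter_eq_of_refineFiltration {j : ℕ} {A : Set Ω}
    (hA : MeasurableSet[M.refineFiltration φ hτ₀ j] A) (t : ℕ) :
    MeasurableSet[M.fullFiltration (t + j)] (A ∩ {ω | τ₀ ω = t}) :=
  ((M.isStoppingTime_shifted φ hτ₀ j).measurableSet_inter_eq_iff A t).1
    (MeasurableSet.inter (M.refineFiltration_le_shifted φ hτ₀ j A hA)
      ((M.isStoppingTime_shifted φ hτ₀ j).measurableSet_eq' t))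

section Posterior

variable [IsProbabilityMeasure P]

theorem hasCondLaw_sample_pairStatus (n k : ℕ) :
    HasCondLaw (M.fullFiltration k) P (M.pairStatus n) (M.Y (2 * n) (k + 1))
      fun a => ((refineFilter f₀ f₁).obs a).law :=
  (M.hasCondLaw_full (2 * n) k).prodMk_left (M.measurable_H_full (2 * n + 1) k)

variable (hfin : ∀ᵐ ω ∂P, τ₀ ω ≠ ⊤)

include hfin

theorem hasCondLaw_refineSample (j : ℕ) : HasCondLaw (M.refineFiltration φ hτ₀ j) P
    (M.stoppedStatus φ τ₀) (M.refineSample φ τ₀ (j + 1))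
      fun a => ((refineFilter f₀ f₁).obs a).law :=
  .of_partition (IsAEPartition.of_ae_ne_top hτ₀.measurable' hfin)
    ((M.refineFiltration φ hτ₀).le j)
    (fun t _ hA => M.measurableSet_inter_eq_of_refineFiltration φ hτ₀ hA t)
    (M.measurable_stoppedStatus φ hτ₀) (M.measurable_refineSample φ hτ₀ (j + 1))
    (θ' := M.status φ) (fun t ω (hω : τ₀ ω = t) => by rw [stoppedStatus, hω]; rfl)
    (x' := fun t ω => M.Y (2 * M.pair φ t ω) (t + j + 1) ω)
    (fun t ω (hω : τ₀ ω = t) => by rw [refineSample, hω]; rfl)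
    fun t => .comp_index (M.fullFiltration.le (t + j))
      ((M.measurable_pair_full φ t).mono (M.fullFiltration.mono (Nat.le_add_right t j)) le_rfl)
      M.measurable_pairStatus (fun n => M.measurable_Y (2 * n) (t + j + 1))
      fun n => M.hasCondLaw_sample_pairStatus n (t + j)

variable (hπ₀ : π₀ ∈ Icc (0 : ℝ) 1)

include hπ₀

theorem isPosterior_refineStat (j : ℕ) : IsPosterior (M.refineFiltration φ hτ₀ j) P
    (M.stoppedStatus φ τ₀) fun ω => refineWeight (M.refineStat φ τ₀ j ω) := by
  induction j with
  | zero =>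
    intro A hA
    simp only [refineStat, refineWeight_refineStart]
    exact IsPosterior.stopped hτ₀ hfin (M.measurable_status φ) (M.isPosterior_stat φ hπ₀) A
      (M.refineFiltration_zero_le φ hτ₀ A hA)
  | succ j ih =>
    exact fun A hA => BayesFilter.isPosterior_update ((M.refineFiltration φ hτ₀).le j)
      (M.measurable_stoppedStatus φ hτ₀) (M.measurable_refineSample φ hτ₀ (j + 1))
      (M.measurable_refineStat φ hτ₀ j) (M.refineStat_mem φ hπ₀ j) ih
      (M.hasCondLaw_refineSample φ hτ₀ hfin j) A (M.refineFiltration_succ_le φ hτ₀ j A hA)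

theorem isControlled_refineStat : (refineFilter f₀ f₁).IsControlled P (M.refineFiltration φ hτ₀)
    (M.refineStat φ τ₀) (M.refineStat φ τ₀) where
  mem_dom := M.refineStat_mem φ hπ₀
  control_mem_dom := M.refineStat_mem φ hπ₀
  setLIntegral_comp_succ j _ hF _ hA :=
    BayesFilter.setLIntegral_observation ((M.refineFiltration φ hτ₀).le j)
      (M.measurable_stoppedStatus φ hτ₀) (M.measurable_refineSample φ hτ₀ (j + 1))
      (M.measurable_refineStat φ hτ₀ j) (M.refineStat_mem φ hπ₀ j)
      (M.isPosterior_refineStat φ hτ₀ hfin hπ₀ j) (M.hasCondLaw_refineSample φ hτ₀ hfin j)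
      (hF.comp (measurable_refineUpdate f₀ f₁)) hA

omit hfin hπ₀ [IsProbabilityMeasure P] in
theorem H_claim_eq_false_iff (b : Bool) (ω : Ω) :
    M.H (2 * M.pair φ ((τ₀ ω).untopD 0) ω + if b then 0 else 1) ω = false ↔
      M.stoppedStatus φ τ₀ ω ∈ errorStatus b := by
  cases b <;> cases hH : M.H (2 * M.pair φ ((τ₀ ω).untopD 0) ω) ω <;>
    simp [errorStatus, stoppedStatus, status, pairStatus, hH]

theorem measure_error_eq (ρ : M.Refinement φ hτ₀) (hfin₁ : ∀ᵐ ω ∂P, ρ.τ₁ ω ≠ ⊤) :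
    P {ω | M.H (2 * M.pair φ ((τ₀ ω).untopD 0) ω + if ρ.δ ω then 0 else 1) ω = false} =
      ∫⁻ ω, ENNReal.ofReal
        (1 - claimProb (ρ.δ ω) (M.refineStat φ τ₀ ((ρ.τ₁ ω).untopD 0) ω)) ∂P := by
  have hpost := IsPosterior.stopped ρ.isStoppingTime hfin₁
    (fun _ => M.measurable_stoppedStatus φ hτ₀) (M.isPosterior_refineStat φ hτ₀ hfin hπ₀)
  have herror := hpost.measure_inter_mem ρ.isStoppingTime.measurableSpace_le
    (M.measurable_stoppedStatus φ hτ₀)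
    (fun a => ((refineFilter f₀ f₁).measurable_weight a).comp
      (measurable_stopped ρ.isStoppingTime (M.measurable_refineStat φ hτ₀)))
    (D := fun ω => errorStatus (ρ.δ ω))
    (fun a => ρ.measurable_δ (MeasurableSet.of_discrete (s := {b | a ∈ errorStatus b})))
    MeasurableSet.univ
  rw [univ_inter, setLIntegral_univ] at herror
  simp only [H_claim_eq_false_iff, herror]
  refine lintegral_congr fun ω => ?_
  rw [← sum_refineWeight_errorStatus]
  exact (ENNReal.ofReal_sum_of_nonneg fun a _ => M.refineStat_mem φ hπ₀ _ ω a).symm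

end Posterior

end SearchModel

theorem hittingAfter_congr {Ω X : Type*} {u v : ℕ → Ω → X} {s : Set X} {n : ℕ} {ω : Ω}
    (h : ∀ k, u k ω = v k ω) : hittingAfter u s n ω = hittingAfter v s n ω := by
  unfold hittingAfter
  congr! 4 <;> simp only [h]

namespace SearchModel

variable {f₀ f₁ : ProbDensity} {π₀ c : ℝ} {Ω : Type u} [mΩ : MeasurableSpace Ω] {P : Measure Ω}
  (M : SearchModel f₀ f₁ π₀ P) (φ : SwitchRule) {τ₀ : Ω → WithTop ℕ}
  (hτ₀ : IsStoppingTime (M.scanFiltration φ) τ₀) (hπ₀ : π₀ ∈ Icc (0 : ℝ) 1) (hc : 0 < c)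

theorem isStoppingTime_hittingAfter_posterior {R : Set (ℝ × ℝ)} (hR : MeasurableSet R) :
    IsStoppingTime (M.scanFiltration φ) (hittingAfter (M.posterior φ) R 0) :=
  Adapted.isStoppingTime_hittingAfter (fun _ => Measurable.prodMk
    stronglyMeasurable_condExp.measurable stronglyMeasurable_condExp.measurable) hR

/-- The optimal refinement: stop as soon as stopping is worth the value of the refinement problem,
and claim the sequence that is more likely to be generated by `f₁`. -/
def optimalRefinement : M.Refinement φ hτ₀ where
  τ₁ := hittingAfter (M.refineStat φ τ₀) (refineProblem f₀ f₁ hc).stopSet 0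
  isStoppingTime := Adapted.isStoppingTime_hittingAfter (M.measurable_refineStat φ hτ₀)
    (refineProblem f₀ f₁ hc).measurableSet_stopSet
  δ ω :=
    let r := M.refineStat φ τ₀
      ((hittingAfter (M.refineStat φ τ₀) (refineProblem f₀ f₁ hc).stopSet 0 ω).untopD 0) ω
    decide (r.2.2 ≤ r.2.1)
  measurable_δ := by
    have hclaim : Measurable fun r : ℝ × ℝ × ℝ => decide (r.2.2 ≤ r.2.1) := by
      refine measurable_to_bool ?_
      simpa only [preimage, mem_singleton_iff, decide_eq_true_eq] using
        measurableSet_le measurable_snd.snd (measurable_snd.fst (α := ℝ × ℝ × ℝ))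
    exact hclaim.comp (measurable_stopped _ (M.measurable_refineStat φ hτ₀))

variable [IsProbabilityMeasure P]

theorem ofReal_scanValue_scanPrior : ENNReal.ofReal (scanValue f₀ f₁ π₀ c (scanPrior π₀)) =
    ∫⁻ ω, ENNReal.ofReal ((scanProblem f₀ f₁ hπ₀ hc).value (M.stat φ 0 ω)) ∂P := by
  rw [scanProblem_value]
  simp only [stat, lintegral_const, measure_univ, mul_one]

include hπ₀

theorem scanCost_eq : M.scanCost φ c τ₀ = ENNReal.ofReal c * ∫⁻ ω, ENat.toENNReal (τ₀ ω) ∂P +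
    ∫⁻ ω, ENNReal.ofReal (scanStopCost f₀ f₁ c (M.stat φ ((τ₀ ω).untopD 0) ω)) ∂P := by
  refine congrArg _ (lintegral_congr_ae ?_)
  filter_upwards [M.posterior_ae_eq φ hπ₀] with ω hω
  rw [hω]

include hc

include hτ₀ in
theorem scanValue_le_scanCost :
    ENNReal.ofReal (scanValue f₀ f₁ π₀ c (scanPrior π₀)) ≤ M.scanCost φ c τ₀ := by
  rw [M.scanCost_eq φ hπ₀, M.ofReal_scanValue_scanPrior φ hπ₀ hc]
  refine (M.isControlled_stat φ hπ₀).lintegral_value_le_stopped (scanProblem f₀ f₁ hπ₀ hc) hτ₀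
    fun k ω => ?_
  unfold nextStat
  split_ifs
  exacts [Or.inr rfl, Or.inl rfl]

theorem expect_value_nextStat
    (hφ : M.SwitchesExactlyOn φ (scanProblem f₀ f₁ hπ₀ hc).switchSet) : ∀ᵐ ω ∂P, ∀ k,
      (scanFilter f₀ f₁).expect (scanProblem f₀ f₁ hπ₀ hc).value (M.nextStat φ k ω) =
        min ((scanFilter f₀ f₁).expect (scanProblem f₀ f₁ hπ₀ hc).value (M.stat φ k ω))
          ((scanFilter f₀ f₁).expect (scanProblem f₀ f₁ hπ₀ hc).value (scanPrior π₀)) := by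
  filter_upwards [M.posterior_ae_eq φ hπ₀, hφ] with ω hω hrule k
  have hswitch := hrule k
  rw [hω] at hswitch
  unfold nextStat
  split_ifs with hk
  · exact (min_eq_right (not_le.1 (hswitch.1 hk).2).le).symm
  · refine (min_eq_left ?_).symm
    by_contra hlt
    exact hk (hswitch.2 ⟨M.stat_mem φ hπ₀ k ω, hlt⟩)

theorem scanCost_hittingAfter_le
    (hφ : M.SwitchesExactlyOn φ (scanProblem f₀ f₁ hπ₀ hc).switchSet) :
    (∀ᵐ ω ∂P, hittingAfter (M.posterior φ) (scanProblem f₀ f₁ hπ₀ hc).stopSet 0 ω ≠ ⊤) ∧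
      M.scanCost φ c (hittingAfter (M.posterior φ) (scanProblem f₀ f₁ hπ₀ hc).stopSet 0) ≤
        ENNReal.ofReal (scanValue f₀ f₁ π₀ c (scanPrior π₀)) := by
  rw [M.scanCost_eq φ hπ₀, M.ofReal_scanValue_scanPrior φ hπ₀ hc]
  refine (M.isControlled_stat φ hπ₀).stopped_le_lintegral_value (scanProblem f₀ f₁ hπ₀ hc)
    (M.isStoppingTime_hittingAfter_posterior φ (scanProblem f₀ f₁ hπ₀ hc).measurableSet_stopSet)
    ?_ (M.expect_value_nextStat φ hπ₀ hc hφ)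
  filter_upwards [M.posterior_ae_eq φ hπ₀] with ω hω
  exact hittingAfter_congr hω

theorem scanCost_le_totalCost (ρ : M.Refinement φ hτ₀) :
    M.scanCost φ c τ₀ ≤ M.totalCost φ c hτ₀ ρ := by
  unfold totalCost
  by_cases htop : ∫⁻ ω, ENat.toENNReal (τ₀ ω + ρ.τ₁ ω) ∂P = ∞
  · rw [htop, ENNReal.mul_top (ENNReal.ofReal_pos.2 hc).ne', top_add]
    exact le_top
  rw [lintegral_toENNReal_add hτ₀.measurable'] at htop ⊢
  obtain ⟨hτ₀top, hτ₁top⟩ := ENNReal.add_ne_top.1 htop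
  have hfin := ae_ne_top_of_lintegral_ne_top hτ₀.measurable' hτ₀top
  have hfin₁ := ae_ne_top_of_lintegral_ne_top ρ.isStoppingTime.measurable' hτ₁top
  rw [M.scanCost_eq φ hπ₀, M.measure_error_eq φ hτ₀ hfin hπ₀ ρ hfin₁, mul_add, add_assoc]
  have hvalue := (M.isControlled_refineStat φ hτ₀ hfin hπ₀).lintegral_value_le_stopped
    (refineProblem f₀ f₁ hc) ρ.isStoppingTime fun _ _ => Or.inl rfl
  rw [refineProblem_value] at hvalue
  refine add_le_add_right (hvalue.trans (add_le_add_right (lintegral_mono fun ω => ?_) _)) _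
  exact ENNReal.ofReal_le_ofReal (refineStopCost_le_one_sub_claimProb _ _)

theorem totalCost_optimalRefinement_le (hfin : ∀ᵐ ω ∂P, τ₀ ω ≠ ⊤) :
    M.totalCost φ c hτ₀ (M.optimalRefinement φ hτ₀ hc) ≤ M.scanCost φ c τ₀ := by
  obtain ⟨hfin₁, hvalue⟩ :=
    (M.isControlled_refineStat φ hτ₀ hfin hπ₀).stopped_le_lintegral_value (refineProblem f₀ f₁ hc)
      (M.optimalRefinement φ hτ₀ hc).isStoppingTime (ae_of_all _ fun _ => rfl)
      (ae_of_all _ fun _ _ => (min_self _).symm)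
  rw [refineProblem_value] at hvalue
  rw [totalCost, lintegral_toENNReal_add hτ₀.measurable', M.scanCost_eq φ hπ₀,
    M.measure_error_eq φ hτ₀ hfin hπ₀ _ hfin₁, mul_add, add_assoc]
  refine add_le_add_right (le_of_eq_of_le (congrArg _ (lintegral_congr fun ω => ?_)) hvalue) _
  exact congrArg ENNReal.ofReal (refineStopCost_eq_one_sub_claimProb _).symm

end SearchModel

end

theorem mainTheorem7_general (f₀ f₁ : ProbDensity) (π₀ : ℝ) (hπ₀ : π₀ ∈ Set.Icc (0 : ℝ) 1)
    (c : ℝ) (hc : 0 < c) :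
    ∃ Rτ Rφ : Set (ℝ × ℝ),
      Rτ ⊆ scanDomain ∧ Rφ ⊆ scanDomain ∧ MeasurableSet Rτ ∧ MeasurableSet Rφ ∧
      (∀ p ∈ scanDomain, p ∈ Rτ ↔ scanStopCost f₀ f₁ c p = scanValue f₀ f₁ π₀ c p) ∧
      (∀ p ∈ scanDomain, p ∈ Rφ ↔ ¬ continueCost f₀ f₁ π₀ c p ≤ switchCost f₀ f₁ π₀ c) ∧
      ∀ (Ω : Type u) [MeasurableSpace Ω] (P : Measure Ω) [IsProbabilityMeasure P]
        (M : SearchModel f₀ f₁ π₀ P),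
        (∃ φ : SwitchRule, M.SwitchesExactlyOn φ Rφ) ∧
        ∀ φ : SwitchRule, M.SwitchesExactlyOn φ Rφ →
          (∀ᵐ ω ∂P, hittingAfter (M.posterior φ) Rτ 0 ω ≠ ⊤) ∧
          ∃ hτ : IsStoppingTime (M.scanFiltration φ) (hittingAfter (M.posterior φ) Rτ 0),
            (∀ (φ' : SwitchRule) (τ' : Ω → WithTop ℕ), IsStoppingTime (M.scanFiltration φ') τ' →
              M.scanCost φ c (hittingAfter (M.posterior φ) Rτ 0) ≤ M.scanCost φ' c τ') ∧
            ∃ ρ : M.Refinement φ hτ,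
              ∀ (φ' : SwitchRule) (τ' : Ω → WithTop ℕ)
                (hτ' : IsStoppingTime (M.scanFiltration φ') τ') (ρ' : M.Refinement φ' hτ'),
                M.totalCost φ c hτ ρ ≤ M.totalCost φ' c hτ' ρ' := by
  have hRτ := (scanProblem f₀ f₁ hπ₀ hc).measurableSet_stopSet
  have hRφ := (scanProblem f₀ f₁ hπ₀ hc).measurableSet_switchSet
  have hdom {p : ℝ × ℝ} (hp : p ∈ (scanFilter f₀ f₁).dom) : p ∈ scanDomain :=
    scanFilter_dom f₀ f₁ ▸ hp
  refine ⟨_, _, fun _ hp => hdom hp.1, fun _ hp => hdom hp.1, hRτ, hRφ,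
    fun _ => mem_stopSet_scanProblem f₀ f₁ hπ₀ hc, fun _ => mem_switchSet_scanProblem f₀ f₁ hπ₀ hc,
    fun Ω _ P _ M => ⟨⟨_, switchesExactlyOn_feedbackRule M hπ₀ hRφ⟩, fun φ hφ => ?_⟩⟩
  obtain ⟨hfin, hle⟩ := M.scanCost_hittingAfter_le φ hπ₀ hc hφ
  have hτ := M.isStoppingTime_hittingAfter_posterior φ hRτ
  have hscan (φ' : SwitchRule) (τ' : Ω → WithTop ℕ) (hτ' : IsStoppingTime _ τ') :=
    hle.trans (M.scanValue_le_scanCost φ' hτ' hπ₀ hc)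
  exact ⟨hfin, hτ, hscan, M.optimalRefinement φ hτ hc, fun φ' τ' hτ' ρ' =>
    ((M.totalCost_optimalRefinement_le φ hτ hπ₀ hc hfin).trans (hscan φ' τ' hτ')).trans
      (M.scanCost_le_totalCost φ' hτ' hπ₀ hc ρ')⟩

theorem mainTheorem7 (f₀ f₁ : ProbDensity) (hne : f₀.law ≠ f₁.law)
    (h₀₁ : f₀.law ≪ f₁.law) (h₁₀ : f₁.law ≪ f₀.law)
    (π₀ : ℝ) (hπ₀ : π₀ ∈ Set.Icc (0 : ℝ) 1) (c : ℝ) (hc : 0 < c) :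
    ∃ Rτ Rφ : Set (ℝ × ℝ),
      Rτ ⊆ scanDomain ∧ Rφ ⊆ scanDomain ∧ MeasurableSet Rτ ∧ MeasurableSet Rφ ∧
      (∀ p ∈ scanDomain, p ∈ Rτ ↔ scanStopCost f₀ f₁ c p = scanValue f₀ f₁ π₀ c p) ∧
      (∀ p ∈ scanDomain, p ∈ Rφ ↔ ¬ continueCost f₀ f₁ π₀ c p ≤ switchCost f₀ f₁ π₀ c) ∧
      ∀ (Ω : Type u) [MeasurableSpace Ω] (P : Measure Ω) [IsProbabilityMeasure P]
        (M : SearchModel f₀ f₁ π₀ P),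
        (∃ φ : SwitchRule, M.SwitchesExactlyOn φ Rφ) ∧
        ∀ φ : SwitchRule, M.SwitchesExactlyOn φ Rφ →
          (∀ᵐ ω ∂P, hittingAfter (M.posterior φ) Rτ 0 ω ≠ ⊤) ∧
          ∃ hτ : IsStoppingTime (M.scanFiltration φ) (hittingAfter (M.posterior φ) Rτ 0),
            (∀ (φ' : SwitchRule) (τ' : Ω → WithTop ℕ), IsStoppingTime (M.scanFiltration φ') τ' →
              M.scanCost φ c (hittingAfter (M.posterior φ) Rτ 0) ≤ M.scanCost φ' c τ') ∧
            ∃ ρ : M.Refinement φ hτ,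
              ∀ (φ' : SwitchRule) (τ' : Ω → WithTop ℕ)
                (hτ' : IsStoppingTime (M.scanFiltration φ') τ') (ρ' : M.Refinement φ' hτ'),
                M.totalCost φ c hτ ρ ≤ M.totalCost φ' c hτ' ρ' :=
  mainTheorem7_general f₀ f₁ π₀ hπ₀ c hc
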